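/- Let $1\le d\le n$, $\delta\in(0,1/2)$, $\theta\in\mathbb R^d$, and observe $Y_i=\eta_i\theta+\xi_i$, $i=1,\dots,n$. The labels $\eta_i\in\{-1,1\}$ form a Markov chain: $\eta_1$ is uniform on $\{-1,1\}$, and $\eta_{i+1}=\eta_i$ with probability $1-\delta$, $\eta_{i+1}=-\eta_i$ with probability $\delta$. The noise vectors $\xi_i$ are i.i.d., independent of $(\eta_i)_i$, isotropic ($\mathbf E\,\xi_i\xi_i^\top=\mathbf I_d$) and $1$-sub-Gaussian ($\mathbf E e^{\langle v,\xi_i\rangle}\le e^{\|v\|^2/2}$ for all $v\in\mathbb R^d$). Write $a\vee b=\max(a,b)$, $a\wedge b=\min(a,b)$, $x_+=x\vee 0$. For an integer $1\le\ell\le n$ put $k=\lfloor n/\ell\rfloor$ and let $I_i=\{(i-1)k+1,\dots,ik\}$, $i=1,\dots,\ell$ (the remaining $n-k\ell$ observations are not used). Let $\tilde Y_i=\frac1k\sum_{j\in I_i}Y_j$, $\bar\eta_i=\frac1k\sum_{j\in I_i}\eta_j$, $\|\bar\eta\|^2=\sum_{i=1}^{\ell}\bar\eta_i^2$, $\hat\Sigma_\ell=\frac1\ell\sum_{i=1}^{\ell}\tilde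 Y_i\tilde Y_i^\top$, and $$\hat\theta(\ell)=\sqrt{\frac{\ell}{\mathbf E\|\bar\eta\|^2}\Big(\lambda_{\max}(\hat\Sigma_\ell)-\frac1k\Big)_+}\;v_{\max}(\hat\Sigma_\ell),$$ where $\lambda_{\max}$ is the largest eigenvalue and $v_{\max}$ is any choice of a corresponding unit eigenvector. (The number $\mathbf E\|\bar\eta\|^2$ depends only on $n,\ell,\delta$.) Two-stage estimator for known $\delta$: let $\hat s=\|\hat\theta(d\vee\lceil n\delta\rceil\wedge n)\|$, and let $\hat\ell$ be the smallest element of the dyadic grid $\{d2^m\wedge n: m=0,1,2,\dots\}$ that is at least $d\vee\lceil n(\delta\vee\hat s^2)\rceil\wedge n$. The estimator is $\hat\theta(\hat\ell)$. Let $\ell(t,\theta)=\min\{\|t-\theta\|,\|t+\theta\|\}$ denote the loss, and let $$\phi(\theta)=\begin{cases}\sqrt{\frac{\delta d}{n}}+\frac dn, & \|\theta\|^2\le\sqrt{\frac{\delta d}{n}}\vee\frac dn,\\[2pt] \frac{\delta d/n}{\|\theta\|^2}, & \sqrt{\frac{\delta d}{n}}\vee\frac dn<\|\theta\|^2\le\delta\vee\frac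 dn,\\[2pt] \frac dn, & \delta\vee\frac dn<\|\theta\|^2.\end{cases}$$ Then there are absolute constants $C,c_0,c_1>0$ (not depending on $d,n,\delta,\theta$, the law of the noise or the choice of $v_{\max}$) such that $$\ell^2(\hat\theta(\hat\ell),\theta)\le C\,\phi(\theta)\quad\text{with probability at least }1-c_1L\,e^{-c_0d},$$ and also $$\ell^2(\hat\theta(\hat\ell),\theta)\le C\Big(\sqrt{\frac{\delta d}{n}}+\frac dn\Big)\quad\text{with probability at least }1-c_1L\,e^{-c_0d},$$ where $L=\log(n/d)$ if $d<n$ and $L=1$ if $d=n$. -/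

import Mathlib

open MeasureTheory ProbabilityTheory Finset

noncomputable section

/-- The probability that a binary symmetric Markov chain with flip probability `δ`, started from a
Rademacher variable, follows the path `s` (for paths of positive length). -/
def chainProb {n : ℕ} (δ : ℝ) (s : Fin n → ℤˣ) : ℝ :=
  1 / 2 * ∏ i : Fin n,
    if h : i.val + 1 < n then (if s ⟨i.val + 1, h⟩ = s i then 1 - δ else δ) else 1

/-- `ξ` is isotropic and `1`-sub-Gaussian: `E ⟨u, ξ⟩⟨v, ξ⟩ = ⟨u, v⟩` and
`E exp ⟨v, ξ⟩ ≤ exp (‖v‖² / 2)` for all `u`, `v` (the latter forces `E ξ = 0`). -/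
structure IsIsotropicSubGaussian {Ω : Type*} [MeasurableSpace Ω] {d : ℕ}
    (ξ : Ω → EuclideanSpace ℝ (Fin d)) (μ : Measure Ω) : Prop where
  isotropic : ∀ u v : EuclideanSpace ℝ (Fin d),
    Integrable (fun ω => inner ℝ u (ξ ω) * inner ℝ v (ξ ω)) μ ∧
      ∫ ω, inner ℝ u (ξ ω) * inner ℝ v (ξ ω) ∂μ = inner ℝ u v
  subGaussian : ∀ v : EuclideanSpace ℝ (Fin d),
    Integrable (fun ω => Real.exp (inner ℝ v (ξ ω))) μ ∧
      ∫ ω, Real.exp (inner ℝ v (ξ ω)) ∂μ ≤ Real.exp (‖v‖ ^ 2 / 2)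

/-- The labels `η` form a binary symmetric Markov chain with flip probability `δ` and Rademacher
initial law; the noise vectors `ξ` are i.i.d. isotropic `1`-sub-Gaussian and independent of `η`. -/
structure IsMarkovMixtureModel {Ω : Type*} [MeasurableSpace Ω] {d n : ℕ} (μ : Measure Ω) (δ : ℝ)
    (η : Fin n → Ω → ℤˣ) (ξ : Fin n → Ω → EuclideanSpace ℝ (Fin d)) : Prop where
  measurable_label : ∀ i, Measurable (η i)
  measurable_noise : ∀ i, Measurable (ξ i)
  label_law : ∀ s : Fin n → ℤˣ, μ.real {ω | ∀ i, η i ω = s i} = chainProb δ s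
  noise_indep : iIndepFun ξ μ
  noise_identDistrib : ∀ i j, IdentDistrib (ξ i) (ξ j) μ μ
  noise_subGaussian : ∀ i, IsIsotropicSubGaussian (ξ i) μ
  noise_indep_label : IndepFun (fun ω i => ξ i ω) (fun ω i => η i ω) μ

/-- The observations `Y i = η i • θ + ξ i`. -/
def observations {Ω : Type*} {d n : ℕ} (θ : EuclideanSpace ℝ (Fin d)) (η : Fin n → Ω → ℤˣ)
    (ξ : Fin n → Ω → EuclideanSpace ℝ (Fin d)) (ω : Ω) : Fin n → EuclideanSpace ℝ (Fin d) :=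
  fun i => (((η i ω : ℤˣ) : ℤ) : ℝ) • θ + ξ i ω

/-- The common length `k = ⌊n / ℓ⌋` of the `ℓ` buckets. -/
def bucketLength (n ℓ : ℕ) : ℕ := n / ℓ

/-- The mean of `y` over the `i`-th of `ℓ` consecutive buckets of length `k = ⌊n / ℓ⌋`
(the last `n - k ℓ` entries are in no bucket). -/
def bucketMean {V : Type*} [AddCommGroup V] [Module ℝ V] {n : ℕ} (ℓ : ℕ) (y : Fin n → V)
    (i : Fin ℓ) : V :=
  (1 / (bucketLength n ℓ : ℝ)) •
    ∑ j ∈ univ.filter (fun j : Fin n => j.val / bucketLength n ℓ = i.val), y j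

/-- `E ‖η̄‖²`, where `η̄ ∈ ℝ^ℓ` is the vector of bucket means of the label chain. -/
def labelEnergy (n : ℕ) (δ : ℝ) (ℓ : ℕ) : ℝ :=
  ∑ s : Fin n → ℤˣ, chainProb δ s *
    ∑ i : Fin ℓ, bucketMean ℓ (fun j => (((s j : ℤˣ) : ℤ) : ℝ)) i ^ 2

/-- `Σ̂ = (1 / ℓ) Ỹ Ỹᵀ`, where the columns of `Ỹ` are the bucket means of the observations. -/
def sampleCov {d n : ℕ} (ℓ : ℕ) (y : Fin n → EuclideanSpace ℝ (Fin d)) :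
    Matrix (Fin d) (Fin d) ℝ :=
  fun a b => 1 / (ℓ : ℝ) * ∑ i : Fin ℓ, bucketMean ℓ y i a * bucketMean ℓ y i b

/-- The top eigenvalue of a real symmetric matrix. -/
def lambdaMax {d : ℕ} (A : Matrix (Fin d) (Fin d) ℝ) : ℝ :=
  sSup {a : ℝ | Module.End.HasEigenvalue (Matrix.toEuclideanLin A) a}

/-- `v` picks, for every real symmetric matrix, a unit eigenvector of its top eigenvalue
(any sign, any vector of the eigenspace). -/
def IsTopEigenvectorChoice {d : ℕ}
    (v : Matrix (Fin d) (Fin d) ℝ → EuclideanSpace ℝ (Fin d)) : Prop :=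
  ∀ A : Matrix (Fin d) (Fin d) ℝ, A.IsSymm →
    ‖v A‖ = 1 ∧ Module.End.HasEigenvector (Matrix.toEuclideanLin A) (lambdaMax A) (v A)

/-- The spectral estimator `θ̂(ℓ)` with `ℓ` buckets. -/
def thetaHat {d n : ℕ} (vmax : Matrix (Fin d) (Fin d) ℝ → EuclideanSpace ℝ (Fin d)) (δ : ℝ)
    (y : Fin n → EuclideanSpace ℝ (Fin d)) (ℓ : ℕ) : EuclideanSpace ℝ (Fin d) :=
  Real.sqrt ((ℓ : ℝ) / labelEnergy n δ ℓ *
      max (lambdaMax (sampleCov ℓ y) - 1 / (bucketLength n ℓ : ℝ)) 0) •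
    vmax (sampleCov ℓ y)

/-- `ŝ = ‖θ̂(d ∨ ⌈n δ⌉ ∧ n)‖`. -/
def sHat {d n : ℕ} (vmax : Matrix (Fin d) (Fin d) ℝ → EuclideanSpace ℝ (Fin d)) (δ : ℝ)
    (y : Fin n → EuclideanSpace ℝ (Fin d)) : ℝ :=
  ‖thetaHat vmax δ y (min (max d ⌈(n : ℝ) * δ⌉₊) n)‖

/-- The smallest element of the dyadic grid `{d 2^m ∧ n : m ∈ ℕ}` that is at least `u`
(for `1 ≤ d` and `u ≤ n`). -/
def dyadicRoundUp (d n u : ℕ) : ℕ :=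
  min (d * 2 ^ sInf {m : ℕ | u ≤ min (d * 2 ^ m) n}) n

/-- The adaptive number of buckets: `d ∨ ⌈n (δ ∨ ŝ²)⌉ ∧ n`, rounded up to the dyadic grid. -/
def ellHat {d n : ℕ} (vmax : Matrix (Fin d) (Fin d) ℝ → EuclideanSpace ℝ (Fin d)) (δ : ℝ)
    (y : Fin n → EuclideanSpace ℝ (Fin d)) : ℕ :=
  dyadicRoundUp d n (min (max d ⌈(n : ℝ) * max δ (sHat vmax δ y ^ 2)⌉₊) n)

/-- The two-stage estimator `θ̂(ℓ̂)`. -/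
def thetaAdaptive {d n : ℕ} (vmax : Matrix (Fin d) (Fin d) ℝ → EuclideanSpace ℝ (Fin d)) (δ : ℝ)
    (y : Fin n → EuclideanSpace ℝ (Fin d)) : EuclideanSpace ℝ (Fin d) :=
  thetaHat vmax δ y (ellHat vmax δ y)

/-- The loss up to a global sign. -/
def signLoss {d : ℕ} (t θ : EuclideanSpace ℝ (Fin d)) : ℝ := min ‖t - θ‖ ‖t + θ‖

/-- The global rate `√(δ d / n) + d / n`. -/
def globalRate (d n : ℕ) (δ : ℝ) : ℝ := Real.sqrt (δ * d / n) + (d : ℝ) / n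

/-- The local rate function; the first case that applies is taken. -/
def localRate {d : ℕ} (n : ℕ) (δ : ℝ) (θ : EuclideanSpace ℝ (Fin d)) : ℝ :=
  if ‖θ‖ ^ 2 ≤ max (Real.sqrt (δ * d / n)) ((d : ℝ) / n) then
    Real.sqrt (δ * d / n) + (d : ℝ) / n
  else if ‖θ‖ ^ 2 ≤ max δ ((d : ℝ) / n) then (δ * d / n) / ‖θ‖ ^ 2
  else (d : ℝ) / n

end

/-! Write D = d/n, q = max(δ, D), T = ‖θ‖² and p = ℓ/n. Averaging over a bucket keeps the signal up
to sign when no flip occurs inside it, and divides the noise covariance by k. Hence the sample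
covariance is αθθᵀ + I/k plus an error, where α is the average squared label mean. `IsSpectralGood`
collects what is needed for one ℓ ≥ max(d, nδ): the error has operator norm of order e = √(TD) +
√(Dp) (cross term and pure noise), α is bounded below, and α is within order (√(δD) + D)/p of its
mean. It fails with probability at most 9e^(-d/128) (`measureReal_not_isSpectralGood_le`).

The noise bounds come from Chernoff estimates on a net. The bound on α rests on the fact that the
squared label means are independent, although the label means are not: they depend only on the flips
inside each bucket. Moreover 1 minus a squared mean lies in [0, 1] and has mean at most kδ, so the
total variance is at most nδ.

On the good event, perturbation of the top eigenpair gives, when e is small against T, a squared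
loss of order e²/T + (α - Eα)²T. The first term is of order D + Dp/T and asks for small p; the
second is of order DqT/p² and asks for p² of order at least qT. The choice p ≈ max(q, T) balances
them and leaves D + Dq/T, the local rate above the threshold T ≈ √(Dq). There the pilot ŝ² is
comparable to T, so the second stage makes this choice. Below the threshold the estimator and θ both
have squared norm of order √(Dq), which is already the rate (`weak_signal`, `strong_signal`,
`signLoss_thetaAdaptive_sq_le`).

The random number of buckets uses the same data, so the good event is imposed on the whole dyadic
grid by a union bound; this produces the logarithmic factor. The global bound holds on the same
event because the local rate never exceeds the global one. -/

/-! ### Independence of blocks and Chernoff bounds. -/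

/-- Restrictions of an independent family to disjoint blocks of indices are independent. -/
theorem iIndepFun_blocks {Ω ι κ : Type*} [MeasurableSpace Ω] {μ : Measure Ω} {β : ι → Type*}
    [∀ i, MeasurableSpace (β i)] {X : ∀ i, Ω → β i} (hX : iIndepFun X μ)
    (hm : ∀ i, Measurable (X i)) (B : κ → Finset ι)
    (hB : ∀ a b, a ≠ b → Disjoint (B a) (B b)) :
    iIndepFun (fun (a : κ) ω (j : B a) => X j ω) μ := by
  classical
  have := hX.isProbabilityMeasure
  rw [iIndepFun_iff_measure_inter_preimage_eq_mul]
  intro S sets hS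
  induction S using Finset.induction_on with
  | empty => simp
  | insert a S ha ih =>
    rw [Finset.prod_insert ha, ← ih fun i hi => hS i (mem_insert_of_mem hi)]
    have hdis : Disjoint (B a) (S.biUnion B) := by
      rw [Finset.disjoint_biUnion_right]
      exact fun b hb => hB a b fun h => ha (h ▸ hb)
    have hind := hX.indepFun_finset _ _ hdis hm
    have hsub : ∀ b ∈ S, B b ⊆ S.biUnion B := fun b hb => Finset.subset_biUnion_of_mem B hb
    -- The events of the blocks in `S` merge into one event about the coordinates in the union of
    -- these blocks, so independence of two disjoint sets of indices suffices.
    let U : Set ((j : ↥(S.biUnion B)) → β j) :=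
      ⋂ b : S, (fun x (j : B b) => x ⟨j, hsub b b.2 j.2⟩) ⁻¹' sets b
    have hU : MeasurableSet U := by
      refine MeasurableSet.iInter fun b => ?_
      refine (measurable_pi_lambda _ fun j => measurable_pi_apply _) ?_
      exact hS b (mem_insert_of_mem b.2)
    have h := hind.measure_inter_preimage_eq_mul (sets a) U (hS a (mem_insert_self a S)) hU
    have hpre : (fun ω (i : ↥(S.biUnion B)) => X i ω) ⁻¹' U
        = ⋂ b ∈ S, (fun ω (j : B b) => X j ω) ⁻¹' sets b := by
      ext ω
      simp [U]
    rw [hpre] at h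
    rw [← h]
    congr 1
    ext ω
    simp

/-- Chernoff bound for a sum of independent variables. -/
theorem measureReal_sum_ge_le {Ω ι : Type*} [Fintype ι] [MeasurableSpace Ω] {μ : Measure Ω}
    [IsProbabilityMeasure μ] {W : ι → Ω → ℝ} (hW : iIndepFun W μ) (hm : ∀ i, Measurable (W i))
    {b : ι → ℝ} (hint : ∀ i, Integrable (fun ω => Real.exp (W i ω)) μ)
    (hb : ∀ i, ∫ ω, Real.exp (W i ω) ∂μ ≤ Real.exp (b i)) (s : ℝ) :
    μ.real {ω | s ≤ ∑ i, W i ω} ≤ Real.exp (∑ i, b i - s) := by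
  have hindE : iIndepFun (fun i ω => Real.exp (W i ω)) μ :=
    hW.comp (fun _ x => Real.exp x) fun _ => Real.measurable_exp
  have hprod : ∫ ω, Real.exp (∑ i, W i ω) ∂μ ≤ Real.exp (∑ i, b i) := by
    simp only [Real.exp_sum]
    rw [hindE.integral_fun_prod_eq_prod_integral fun i => (hint i).aestronglyMeasurable]
    exact Finset.prod_le_prod (fun i _ => integral_nonneg fun ω => (Real.exp_pos _).le)
      fun i _ => hb i
  have hI : Integrable (fun ω => Real.exp (∑ i, W i ω)) μ := by
    simp only [Real.exp_sum]
    refine (Integrable.congr ?_ (Filter.Eventually.of_forall fun ω => rfl))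
    refine ⟨Finset.aestronglyMeasurable_fun_prod _ fun i _ => (hint i).aestronglyMeasurable, ?_⟩
    rw [HasFiniteIntegral]
    have h1 : ∀ ω, ‖∏ i, Real.exp (W i ω)‖ₑ = ∏ i, ENNReal.ofReal (Real.exp (W i ω)) := by
      intro ω
      rw [← ENNReal.ofReal_prod_of_nonneg fun i _ => (Real.exp_pos _).le,
        Real.enorm_eq_ofReal (Finset.prod_nonneg fun i _ => (Real.exp_pos _).le)]
    simp only [h1]
    rw [lintegral_prod_eq_prod_lintegral_of_indepFun univ
      (fun i ω => ENNReal.ofReal (Real.exp (W i ω)))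
      (hindE.comp (fun _ x => ENNReal.ofReal x) fun _ => ENNReal.measurable_ofReal)
      fun i => (Real.measurable_exp.comp (hm i)).ennreal_ofReal]
    refine ENNReal.prod_lt_top fun i _ => ?_
    rw [← ofReal_integral_eq_lintegral_ofReal (hint i)
      (Filter.Eventually.of_forall fun ω => (Real.exp_pos _).le)]
    exact ENNReal.ofReal_lt_top
  have hmk := mul_meas_ge_le_integral_of_nonneg (μ := μ)
    (Filter.Eventually.of_forall fun ω => (Real.exp_pos (∑ i, W i ω)).le) hI (Real.exp s)
  simp only [Real.exp_le_exp] at hmk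
  rw [sub_eq_add_neg, Real.exp_add, Real.exp_neg, ← div_eq_mul_inv, le_div_iff₀ (Real.exp_pos s),
    mul_comm]
  exact hmk.trans hprod

/-- Moment generating function of a `[0, 1]`-valued variable. -/
theorem integral_exp_mul_le_of_mem_Icc {Ω : Type*} [MeasurableSpace Ω] {μ : Measure Ω}
    [IsProbabilityMeasure μ] {W : Ω → ℝ} (hm : Measurable W) (h0 : ∀ ω, 0 ≤ W ω)
    (h1 : ∀ ω, W ω ≤ 1) {t : ℝ} (ht : |t| ≤ 1) :
    Integrable (fun ω => Real.exp (t * W ω)) μ ∧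
      ∫ ω, Real.exp (t * W ω) ∂μ ≤ Real.exp ((t + t ^ 2) * ∫ ω, W ω ∂μ) := by
  have hW : Integrable W μ := Integrable.of_bound hm.aestronglyMeasurable 1
    (Filter.Eventually.of_forall fun ω => by rw [Real.norm_eq_abs, abs_of_nonneg (h0 ω)]; exact h1 ω)
  have habs : ∀ ω, |t * W ω| ≤ 1 := fun ω => by
    rw [abs_mul, abs_of_nonneg (h0 ω)]
    exact mul_le_one₀ ht (h0 ω) (h1 ω)
  have hI : Integrable (fun ω => Real.exp (t * W ω)) μ := by
    refine Integrable.of_bound (by fun_prop) (Real.exp 1)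
      (Filter.Eventually.of_forall fun ω => ?_)
    rw [Real.norm_eq_abs, abs_of_pos (Real.exp_pos _)]
    exact Real.exp_le_exp.2 ((le_abs_self _).trans (habs ω))
  refine ⟨hI, ?_⟩
  -- Since W² ≤ W on [0, 1], the quadratic term is controlled by the mean; this makes the deviation
  -- bound of Bernstein type, sharp for small means.
  have hpt : ∀ ω, Real.exp (t * W ω) ≤ 1 + (t + t ^ 2) * W ω := fun ω => by
    have h := (le_abs_self _).trans (Real.abs_exp_sub_one_sub_id_le (habs ω))
    nlinarith [mul_nonneg (sq_nonneg t) (mul_nonneg (h0 ω) (sub_nonneg.2 (h1 ω)))]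
  calc ∫ ω, Real.exp (t * W ω) ∂μ ≤ ∫ ω, (1 + (t + t ^ 2) * W ω) ∂μ :=
        integral_mono hI ((integrable_const _).add (hW.const_mul _)) hpt
    _ = 1 + (t + t ^ 2) * ∫ ω, W ω ∂μ := by
        rw [integral_add (integrable_const _) (hW.const_mul _), integral_const_mul]
        simp
    _ ≤ _ := by linarith [Real.add_one_le_exp ((t + t ^ 2) * ∫ ω, W ω ∂μ)]

/-- Bernstein-type deviation bound for independent `[0, 1]`-valued variables. -/
theorem measureReal_sum_mul_ge_le_of_mem_Icc {Ω ι : Type*} [Fintype ι] [MeasurableSpace Ω]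
    {μ : Measure Ω} [IsProbabilityMeasure μ] {W : ι → Ω → ℝ} (hW : iIndepFun W μ)
    (hm : ∀ i, Measurable (W i)) (h0 : ∀ i ω, 0 ≤ W i ω) (h1 : ∀ i ω, W i ω ≤ 1)
    {t : ℝ} (ht : |t| ≤ 1) (s : ℝ) :
    μ.real {ω | t * ∑ i, ∫ ω, W i ω ∂μ + s ≤ t * ∑ i, W i ω} ≤
      Real.exp (t ^ 2 * ∑ i, ∫ ω, W i ω ∂μ - s) := by
  have h := measureReal_sum_ge_le (μ := μ) (W := fun i ω => t * W i ω)
    (b := fun i => (t + t ^ 2) * ∫ ω, W i ω ∂μ)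
    (hW.comp (fun _ x => t * x) fun _ => by fun_prop) (fun i => (hm i).const_mul t)
    (fun i => (integral_exp_mul_le_of_mem_Icc (hm i) (h0 i) (h1 i) ht).1)
    (fun i => (integral_exp_mul_le_of_mem_Icc (hm i) (h0 i) (h1 i) ht).2)
    (t * ∑ i, ∫ ω, W i ω ∂μ + s)
  simp only [← Finset.mul_sum] at h
  refine h.trans_eq ?_
  congr 1
  ring

/-! ### Squares of sub-Gaussian variables. -/

/-- Gaussian linearization, by completing the square: exp(x²/4) becomes an average of exponentials
linear in x, to which a bound on the moment generating function applies. -/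
theorem integral_exp_neg_sq_add_mul (x : ℝ) :
    ∫ y : ℝ, Real.exp (-y ^ 2 + y * x) = Real.sqrt Real.pi * Real.exp (x ^ 2 / 4) := by
  have h : ∀ y : ℝ, Real.exp (-y ^ 2 + y * x)
      = Real.exp (x ^ 2 / 4) * Real.exp (-1 * (y - x / 2) ^ 2) := fun y => by
    rw [← Real.exp_add]; congr 1; ring
  simp only [h]
  rw [integral_const_mul, integral_sub_right_eq_self (fun y : ℝ => Real.exp (-1 * y ^ 2)),
    integral_gaussian]
  simp [mul_comm]

theorem integrable_exp_neg_sq_add_mul (x : ℝ) :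
    Integrable fun y : ℝ => Real.exp (-y ^ 2 + y * x) := by
  by_contra h
  have h1 := integral_exp_neg_sq_add_mul x
  -- The Bochner integral of a non-integrable function is 0, but the value just computed is
  -- positive.
  rw [integral_undef h] at h1
  have : 0 < Real.sqrt Real.pi * Real.exp (x ^ 2 / 4) := by positivity
  exact this.ne h1

/-- Exponential integrability of the square of a sub-Gaussian variable. -/
theorem lintegral_exp_sq_div_four_le {Ω : Type*} [MeasurableSpace Ω] {μ : Measure Ω}
    [IsProbabilityMeasure μ] {X : Ω → ℝ} (hm : Measurable X) (hX : HasSubgaussianMGF X 1 μ) :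
    ∫⁻ ω, ENNReal.ofReal (Real.exp (X ω ^ 2 / 4)) ∂μ ≤ ENNReal.ofReal (Real.sqrt 2) := by
  have hpi : 0 < Real.sqrt Real.pi := by positivity
  have h1 : ∀ ω, ENNReal.ofReal (Real.sqrt Real.pi) * ENNReal.ofReal (Real.exp (X ω ^ 2 / 4))
      = ∫⁻ y : ℝ, ENNReal.ofReal (Real.exp (-y ^ 2 + y * X ω)) := fun ω => by
    rw [← ENNReal.ofReal_mul hpi.le, ← integral_exp_neg_sq_add_mul,
      ofReal_integral_eq_lintegral_ofReal (integrable_exp_neg_sq_add_mul _)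
        (Filter.Eventually.of_forall fun y => (Real.exp_pos _).le)]
  -- After Tonelli, the expectation for fixed y is at most exp(-y² + y²/2), and √2 is the ratio
  -- √(2π)/√π.
  have h2 : ENNReal.ofReal (Real.sqrt Real.pi) * ∫⁻ ω, ENNReal.ofReal (Real.exp (X ω ^ 2 / 4)) ∂μ
      ≤ ENNReal.ofReal (Real.sqrt Real.pi) * ENNReal.ofReal (Real.sqrt 2) := by
    rw [← lintegral_const_mul _ (by fun_prop)]
    simp only [h1]
    rw [lintegral_lintegral_swap (by fun_prop)]
    have h3 : ∀ y : ℝ, ∫⁻ ω, ENNReal.ofReal (Real.exp (-y ^ 2 + y * X ω)) ∂μ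
        ≤ ENNReal.ofReal (Real.exp (-(1 / 2) * y ^ 2)) := fun y => by
      simp only [Real.exp_add]
      rw [← ofReal_integral_eq_lintegral_ofReal ((hX.integrable_exp_mul y).const_mul _)
        (Filter.Eventually.of_forall fun ω => by positivity), integral_const_mul]
      refine ENNReal.ofReal_le_ofReal ?_
      calc Real.exp (-y ^ 2) * ∫ ω, Real.exp (y * X ω) ∂μ
          ≤ Real.exp (-y ^ 2) * Real.exp ((1 : NNReal) * y ^ 2 / 2) :=
            mul_le_mul_of_nonneg_left (hX.mgf_le y) (Real.exp_pos _).le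
        _ = _ := by rw [← Real.exp_add]; congr 1; push_cast; ring
    refine (lintegral_mono h3).trans ?_
    rw [← ofReal_integral_eq_lintegral_ofReal (integrable_exp_neg_mul_sq (by norm_num))
      (Filter.Eventually.of_forall fun y => (Real.exp_pos _).le), integral_gaussian,
      ← ENNReal.ofReal_mul hpi.le, ← Real.sqrt_mul Real.pi_pos.le]
    refine ENNReal.ofReal_le_ofReal (le_of_eq ?_)
    congr 1
    ring
  rwa [ENNReal.mul_le_mul_iff_right (by simpa using hpi) ENNReal.ofReal_ne_top] at h2

theorem integrable_exp_sq_div_four {Ω : Type*} [MeasurableSpace Ω] {μ : Measure Ω}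
    [IsProbabilityMeasure μ] {X : Ω → ℝ} (hm : Measurable X) (hX : HasSubgaussianMGF X 1 μ) :
    Integrable (fun ω => Real.exp (X ω ^ 2 / 4)) μ := by
  refine ⟨by fun_prop, ?_⟩
  rw [hasFiniteIntegral_iff_ofReal (Filter.Eventually.of_forall fun ω => (Real.exp_pos _).le)]
  exact (lintegral_exp_sq_div_four_le hm hX).trans_lt ENNReal.ofReal_lt_top

theorem integral_exp_sq_div_four_le {Ω : Type*} [MeasurableSpace Ω] {μ : Measure Ω}
    [IsProbabilityMeasure μ] {X : Ω → ℝ} (hm : Measurable X) (hX : HasSubgaussianMGF X 1 μ) :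
    ∫ ω, Real.exp (X ω ^ 2 / 4) ∂μ ≤ Real.sqrt 2 := by
  rw [← ENNReal.ofReal_le_ofReal_iff (Real.sqrt_nonneg _),
    ofReal_integral_eq_lintegral_ofReal (integrable_exp_sq_div_four hm hX)
    (Filter.Eventually.of_forall fun ω => (Real.exp_pos _).le)]
  exact lintegral_exp_sq_div_four_le hm hX

theorem Real.exp_le_one_add_add_sq_mul_exp_abs (a : ℝ) :
    Real.exp a ≤ 1 + a + a ^ 2 * Real.exp |a| := by
  have h1 : 1 ≤ Real.exp |a| := Real.one_le_exp (abs_nonneg a)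
  rcases le_or_gt |a| 1 with h | h
  · have := (le_abs_self _).trans (Real.abs_exp_sub_one_sub_id_le h)
    nlinarith [sq_nonneg a]
  · rcases le_total 0 a with h0 | h0
    · rw [abs_of_nonneg h0] at *
      have := le_mul_of_one_le_left (Real.exp_pos a).le (show 1 ≤ a ^ 2 by nlinarith)
      linarith
    · rw [abs_of_nonpos h0] at *
      have : Real.exp a ≤ 1 := Real.exp_le_one_iff.2 h0
      nlinarith

/-- The centred square of a sub-Gaussian variable is sub-exponential. -/
theorem integral_exp_mul_sq_sub_one_le {Ω : Type*} [MeasurableSpace Ω] {μ : Measure Ω}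
    [IsProbabilityMeasure μ] {X : Ω → ℝ} (hm : Measurable X) (hX : HasSubgaussianMGF X 1 μ)
    (hX2 : ∫ ω, X ω ^ 2 ∂μ = 1) {t : ℝ} (ht : |t| ≤ 1 / 16) :
    Integrable (fun ω => Real.exp (t * (X ω ^ 2 - 1))) μ ∧
      ∫ ω, Real.exp (t * (X ω ^ 2 - 1)) ∂μ ≤ Real.exp (1024 * t ^ 2) := by
  have hsq : Integrable (fun ω => X ω ^ 2) μ := (hX.memLp 2).integrable_sq
  have he := integrable_exp_sq_div_four hm hX
  have h2 := integral_exp_sq_div_four_le hm hX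
  have hpt : ∀ ω, Real.exp (t * (X ω ^ 2 - 1)) ≤
      (1 + t * (X ω ^ 2 - 1)) + 512 * Real.exp (1 / 8) * t ^ 2 * Real.exp (X ω ^ 2 / 4) := by
    intro ω
    set q := X ω ^ 2 with hq
    have hq0 : 0 ≤ q := sq_nonneg _
    have h := Real.exp_le_one_add_add_sq_mul_exp_abs (t * (q - 1))
    have hA : |t * (q - 1)| ≤ (q + 1) / 16 := by
      rw [abs_mul]
      have : |q - 1| ≤ q + 1 := abs_le.2 ⟨by linarith, by linarith⟩
      calc |t| * |q - 1| ≤ 1 / 16 * (q + 1) := mul_le_mul ht this (abs_nonneg _) (by norm_num)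
        _ = _ := by ring
    -- With x = (q + 1)/16, (q - 1)² ≤ 256x² ≤ 512eˣ. Together with `hA` the exponent is (q + 1)/8,
    -- within reach of the moment of exp(q/4).
    have hE : (q - 1) ^ 2 ≤ 512 * Real.exp ((q + 1) / 16) := by
      have := Real.quadratic_le_exp_of_nonneg (x := (q + 1) / 16) (by positivity)
      nlinarith
    have hF : (q - 1) ^ 2 * Real.exp |t * (q - 1)| ≤ 512 * (Real.exp (1 / 8) * Real.exp (q / 4)) := by
      calc (q - 1) ^ 2 * Real.exp |t * (q - 1)|
          ≤ 512 * Real.exp ((q + 1) / 16) * Real.exp ((q + 1) / 16) :=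
            mul_le_mul hE (Real.exp_le_exp.2 hA) (Real.exp_pos _).le (by positivity)
        _ = 512 * Real.exp ((q + 1) / 8) := by rw [mul_assoc, ← Real.exp_add]; ring_nf
        _ ≤ 512 * Real.exp (1 / 8 + q / 4) := by
            gcongr; linarith
        _ = _ := by rw [Real.exp_add]
    have := mul_le_mul_of_nonneg_left hF (sq_nonneg t)
    nlinarith
  have hJ : Integrable (fun ω => t * (X ω ^ 2 - 1)) μ := (hsq.sub (integrable_const _)).const_mul t
  have hJ1 : Integrable (fun ω => 1 + t * (X ω ^ 2 - 1)) μ := (integrable_const _).add hJ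
  have hdom : Integrable (fun ω => (1 + t * (X ω ^ 2 - 1)) +
      512 * Real.exp (1 / 8) * t ^ 2 * Real.exp (X ω ^ 2 / 4)) μ :=
    hJ1.add (he.const_mul _)
  have hI : Integrable (fun ω => Real.exp (t * (X ω ^ 2 - 1))) μ := by
    refine hdom.mono' (by fun_prop) (Filter.Eventually.of_forall fun ω => ?_)
    rw [Real.norm_eq_abs, abs_of_pos (Real.exp_pos _)]
    exact hpt ω
  refine ⟨hI, (integral_mono hI hdom hpt).trans ?_⟩
  rw [integral_add hJ1 (he.const_mul _), integral_add (integrable_const _) hJ, integral_const_mul,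
    integral_const_mul,
    integral_sub hsq (integrable_const _), hX2]
  have hc : Real.exp (1 / 8) * Real.sqrt 2 ≤ 2 := by
    have h1 : Real.exp (1 / 8) ≤ 1.25 := by
      have := Real.abs_exp_sub_one_sub_id_le (x := 1 / 8) (by norm_num [abs_of_pos])
      have := (le_abs_self _).trans this
      linarith
    have h2 : Real.sqrt 2 ≤ 1.5 := Real.sqrt_le_iff.2 ⟨by norm_num, by norm_num⟩
    calc _ ≤ 1.25 * 1.5 := mul_le_mul h1 h2 (Real.sqrt_nonneg _) (by norm_num)
      _ ≤ 2 := by norm_num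
  have h3 : 512 * Real.exp (1 / 8) * t ^ 2 * ∫ ω, Real.exp (X ω ^ 2 / 4) ∂μ ≤ 1024 * t ^ 2 := by
    calc _ ≤ 512 * Real.exp (1 / 8) * t ^ 2 * Real.sqrt 2 :=
          mul_le_mul_of_nonneg_left h2 (by positivity)
      _ = 512 * t ^ 2 * (Real.exp (1 / 8) * Real.sqrt 2) := by ring
      _ ≤ 512 * t ^ 2 * 2 := mul_le_mul_of_nonneg_left hc (by positivity)
      _ = _ := by ring
  have := Real.add_one_le_exp (1024 * t ^ 2)
  simp only [integral_const, probReal_univ, smul_eq_mul, mul_one, sub_self, mul_zero]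
  linarith

/-- Concentration of a sum of squares of independent standardized sub-Gaussian variables. -/
theorem measureReal_abs_sum_sq_sub_one_ge_le {Ω : Type*} [MeasurableSpace Ω] {μ : Measure Ω}
    [IsProbabilityMeasure μ] {d ℓ : ℕ} (hd : 1 ≤ d) (hdl : d ≤ ℓ) {X : Fin ℓ → Ω → ℝ}
    (hind : iIndepFun X μ) (hm : ∀ i, Measurable (X i)) (hX : ∀ i, HasSubgaussianMGF (X i) 1 μ)
    (hX2 : ∀ i, ∫ ω, X i ω ^ 2 ∂μ = 1) :
    μ.real {ω | 144 * Real.sqrt (d * ℓ) ≤ |∑ i, (X i ω ^ 2 - 1)|} ≤ 2 * Real.exp (-5 * d) := by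
  have hl : (0 : ℝ) < ℓ := by exact_mod_cast hd.trans hdl
  have hd0 : (0 : ℝ) < d := by exact_mod_cast hd
  have hdl' : (d : ℝ) ≤ ℓ := by exact_mod_cast hdl
  -- The threshold contributes -9d and the moment bound +4d to the exponent. The remaining -5d is
  -- meant to beat the 25^d ≤ e^(4d) pairs of net points. The condition d ≤ ℓ gives t ≤ 1/16.
  set t : ℝ := Real.sqrt (d / ℓ) / 16 with ht
  have ht0 : 0 < t := by positivity
  have ht1 : t ≤ 1 / 16 := by
    have : Real.sqrt (d / ℓ) ≤ 1 := Real.sqrt_le_one.2 ((div_le_one hl).2 hdl')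
    rw [ht]; linarith
  have hts : t * (144 * Real.sqrt (d * ℓ)) = 9 * d := by
    have : Real.sqrt (d / ℓ) * Real.sqrt (d * ℓ) = d := by
      rw [← Real.sqrt_mul (by positivity)]
      have : (d : ℝ) / ℓ * (d * ℓ) = d ^ 2 := by field_simp
      rw [this, Real.sqrt_sq hd0.le]
    rw [ht]; linear_combination 9 * this
  have htl : 1024 * t ^ 2 * ℓ = 4 * d := by
    rw [ht, div_pow, Real.sq_sqrt (by positivity)]; field_simp; norm_num
  have key : ∀ u : ℝ, |u| ≤ 1 / 16 → u ^ 2 = t ^ 2 →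
      μ.real {ω | 9 * (d : ℝ) ≤ ∑ i, u * (X i ω ^ 2 - 1)} ≤ Real.exp (-5 * d) := by
    intro u hu hut
    have h := measureReal_sum_ge_le (μ := μ) (W := fun i ω => u * (X i ω ^ 2 - 1))
      (b := fun _ => 1024 * u ^ 2)
      (hind.comp (fun _ x => u * (x ^ 2 - 1)) fun _ => by fun_prop) (fun i => by fun_prop)
      (fun i => (integral_exp_mul_sq_sub_one_le (hm i) (hX i) (hX2 i) hu).1)
      (fun i => (integral_exp_mul_sq_sub_one_le (hm i) (hX i) (hX2 i) hu).2) (9 * d)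
    refine h.trans_eq ?_
    congr 1
    simp only [sum_const, card_univ, Fintype.card_fin, nsmul_eq_mul, hut]
    linarith
  have hsub : {ω | 144 * Real.sqrt (d * ℓ) ≤ |∑ i, (X i ω ^ 2 - 1)|} ⊆
      {ω | 9 * (d : ℝ) ≤ ∑ i, t * (X i ω ^ 2 - 1)} ∪
      {ω | 9 * (d : ℝ) ≤ ∑ i, -t * (X i ω ^ 2 - 1)} := by
    intro ω hω
    simp only [Set.mem_ofPred_eq] at hω
    simp only [Set.mem_union, Set.mem_ofPred_eq, ← Finset.mul_sum]
    have := mul_le_mul_of_nonneg_left hω ht0.le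
    rw [hts] at this
    rcases abs_cases (∑ i, (X i ω ^ 2 - 1)) with ⟨h, _⟩ | ⟨h, _⟩ <;> rw [h] at this
    · left; exact this
    · right; linarith
  refine (measureReal_mono hsub).trans ((measureReal_union_le _ _).trans ?_)
  have h1 := key t (by rwa [abs_of_pos ht0]) rfl
  have h2 := key (-t) (by rwa [abs_neg, abs_of_pos ht0]) (by ring)
  linarith

/-! ### Nets and operator norms. -/

/-- The unit ball of `ℝ^d` has a `1/2`-net with at most `5 ^ d` elements. -/
theorem exists_half_net (d : ℕ) : ∃ N : Finset (EuclideanSpace ℝ (Fin d)), #N ≤ 5 ^ d ∧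
    (∀ u ∈ N, ‖u‖ ≤ 1) ∧ ∀ x : EuclideanSpace ℝ (Fin d), ‖x‖ ≤ 1 → ∃ u ∈ N, ‖x - u‖ ≤ 1 / 2 := by
  classical
  -- The net is a 1/2-separated subset of the ball of maximal cardinality. Doubling it gives a
  -- 1-separated set in the ball of radius 2, to which the packing bound 5^d applies; a point far
  -- from the net could be added to it.
  let P : ℕ → Prop := fun m => ∃ N : Finset (EuclideanSpace ℝ (Fin d)), #N = m ∧
    (∀ u ∈ N, ‖u‖ ≤ 1) ∧ ∀ u ∈ N, ∀ v ∈ N, u ≠ v → 1 / 2 ≤ ‖u - v‖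
  have hbound : ∀ m, P m → m ≤ 5 ^ d := by
    rintro m ⟨N, rfl, hN1, hN2⟩
    have hinj : Function.Injective fun u : EuclideanSpace ℝ (Fin d) => (2 : ℝ) • u :=
      smul_right_injective _ two_ne_zero
    have h := Besicovitch.card_le_of_separated (N.image fun u => (2 : ℝ) • u) ?_ ?_
    · rwa [Finset.card_image_of_injective _ hinj, finrank_euclideanSpace_fin] at h
    · simp only [mem_image, forall_exists_index, and_imp, forall_apply_eq_imp_iff₂, norm_smul]
      intro u hu
      have := hN1 u hu
      norm_num
      linarith
    · simp only [mem_image, forall_exists_index, and_imp, forall_apply_eq_imp_iff₂, ← smul_sub,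
        norm_smul]
      intro u hu v hv huv
      have := hN2 u hu v hv fun h => huv (h ▸ rfl)
      norm_num
      linarith
  have h0 : P 0 := ⟨∅, by simp⟩
  have hP := Nat.findGreatest_spec (P := P) (Nat.zero_le (5 ^ d)) h0
  obtain ⟨N, hNc, hN1, hN2⟩ := hP
  refine ⟨N, hNc ▸ Nat.findGreatest_le _, hN1, fun x hx => ?_⟩
  by_contra! hfar
  have hxN : x ∉ N := fun h => by
    have := hfar x h
    norm_num at this
  have hQ : P (#N + 1) := by
    refine ⟨insert x N, card_insert_of_notMem hxN, ?_, ?_⟩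
    · intro u hu
      rcases mem_insert.1 hu with rfl | hu
      · exact hx
      · exact hN1 u hu
    · intro u hu v hv huv
      rcases mem_insert.1 hu with hu' | hu' <;> rcases mem_insert.1 hv with hv' | hv'
      · exact absurd (hu'.trans hv'.symm) huv
      · exact hu' ▸ (hfar v hv').le
      · rw [norm_sub_rev]; exact hv' ▸ (hfar u hu').le
      · exact hN2 u hu' v hv' huv
  have := Nat.le_findGreatest (hbound _ hQ) hQ
  omega

/-- Approximating a unit vector by the net gives ‖F‖ ≤ s + ‖F‖/2, hence the factor 2; a bilinear
form pays it once per variable. -/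
theorem abs_linearMap_le_of_net {d : ℕ} {N : Finset (EuclideanSpace ℝ (Fin d))}
    (hN : ∀ x : EuclideanSpace ℝ (Fin d), ‖x‖ ≤ 1 → ∃ u ∈ N, ‖x - u‖ ≤ 1 / 2)
    (f : EuclideanSpace ℝ (Fin d) →ₗ[ℝ] ℝ) {s : ℝ}
    (hf : ∀ u ∈ N, |f u| ≤ s) (x : EuclideanSpace ℝ (Fin d)) : |f x| ≤ 2 * s * ‖x‖ := by
  obtain ⟨u₀, hu₀, -⟩ := hN 0 (by simp)
  have hs : 0 ≤ s := (abs_nonneg _).trans (hf u₀ hu₀)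
  set F := LinearMap.toContinuousLinearMap f
  have h : ‖F‖ ≤ s + ‖F‖ / 2 := by
    refine ContinuousLinearMap.opNorm_le_of_unit_norm (by positivity) fun x hx => ?_
    obtain ⟨u, hu, hxu⟩ := hN x hx.le
    have h1 : F x = F u + F (x - u) := by rw [← map_add]; congr 1; abel
    rw [h1]
    refine (norm_add_le _ _).trans (add_le_add (hf u hu) ?_)
    refine (F.le_opNorm _).trans ?_
    nlinarith [norm_nonneg F]
  calc |f x| = ‖F x‖ := rfl
    _ ≤ ‖F‖ * ‖x‖ := F.le_opNorm x
    _ ≤ _ := mul_le_mul_of_nonneg_right (by linarith) (norm_nonneg _)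

theorem abs_bilin_le_of_net {d : ℕ} {N : Finset (EuclideanSpace ℝ (Fin d))}
    (hN : ∀ x : EuclideanSpace ℝ (Fin d), ‖x‖ ≤ 1 → ∃ u ∈ N, ‖x - u‖ ≤ 1 / 2)
   
    (B : EuclideanSpace ℝ (Fin d) →ₗ[ℝ] EuclideanSpace ℝ (Fin d) →ₗ[ℝ] ℝ) {s : ℝ}
    (hB : ∀ u ∈ N, ∀ v ∈ N, |B u v| ≤ s) (x y : EuclideanSpace ℝ (Fin d)) :
    |B x y| ≤ 4 * s * ‖x‖ * ‖y‖ := by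
  have h := abs_linearMap_le_of_net hN (B.flip y) (s := 2 * s * ‖y‖)
    (fun u hu => abs_linearMap_le_of_net hN (B u) (hB u hu) y) x
  rw [LinearMap.flip_apply] at h
  linarith

theorem norm_le_of_net {d : ℕ} {N : Finset (EuclideanSpace ℝ (Fin d))}
    (hN : ∀ x : EuclideanSpace ℝ (Fin d), ‖x‖ ≤ 1 → ∃ u ∈ N, ‖x - u‖ ≤ 1 / 2)
    (w : EuclideanSpace ℝ (Fin d)) {s : ℝ}
    (hw : ∀ u ∈ N, |inner ℝ u w| ≤ s) : ‖w‖ ≤ 2 * s := by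
  have h := abs_linearMap_le_of_net hN ((innerₗ (EuclideanSpace ℝ (Fin d))).flip w) hw w
  rw [LinearMap.flip_apply, innerₗ_apply_apply, real_inner_self_eq_norm_sq,
    abs_of_nonneg (sq_nonneg _)] at h
  rcases (norm_nonneg w).eq_or_lt' with h0 | h0
  · rw [h0]
    obtain ⟨u₀, hu₀, -⟩ := hN 0 (by simp)
    linarith [(abs_nonneg _).trans (hw u₀ hu₀)]
  · nlinarith

/-- The σ-algebra of units is pulled back along the injection into ℤ. Consequently every function of
a label path is measurable. -/
instance : DiscreteMeasurableSpace ℤˣ where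
  forall_measurableSet s := ⟨Units.val '' s, trivial, Set.preimage_image_eq s Units.val_injective⟩

/-! ### Buckets -/

/-- The indices of the `i`-th bucket. -/
def bucket (n ℓ i : ℕ) : Finset (Fin n) := univ.filter fun j => j.val / bucketLength n ℓ = i

theorem mem_bucket {n ℓ i : ℕ} {j : Fin n} :
    j ∈ bucket n ℓ i ↔ j.val / bucketLength n ℓ = i := by simp [bucket]

theorem bucketMean_def {V : Type*} [AddCommGroup V] [Module ℝ V] {n : ℕ} (ℓ : ℕ) (y : Fin n → V)
    (i : Fin ℓ) :
    bucketMean ℓ y i = (1 / (bucketLength n ℓ : ℝ)) • ∑ j ∈ bucket n ℓ i, y j := rfl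

theorem disjoint_bucket {n ℓ i j : ℕ} (h : i ≠ j) : Disjoint (bucket n ℓ i) (bucket n ℓ j) := by
  rw [Finset.disjoint_left]
  intro a ha hb
  exact h ((mem_bucket.1 ha).symm.trans (mem_bucket.1 hb))

theorem bucketLength_pos {n ℓ : ℕ} (hl : 1 ≤ ℓ) (hln : ℓ ≤ n) : 0 < bucketLength n ℓ :=
  Nat.div_pos hln hl

theorem lt_of_div_bucketLength {n ℓ j : ℕ} (hl : 1 ≤ ℓ) (hln : ℓ ≤ n)
    (hj : j / bucketLength n ℓ < ℓ) : j < n := by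
  have h1 := (Nat.div_lt_iff_lt_mul (bucketLength_pos hl hln)).1 hj
  exact h1.trans_le (Nat.mul_div_le n ℓ)

theorem card_bucket {n ℓ : ℕ} (hl : 1 ≤ ℓ) (hln : ℓ ≤ n) (i : Fin ℓ) :
    #(bucket n ℓ i) = bucketLength n ℓ := by
  have hk := bucketLength_pos hl hln
  have h : (bucket n ℓ i).map Fin.valEmbedding =
      Ico (i * bucketLength n ℓ) (i * bucketLength n ℓ + bucketLength n ℓ) := by
    ext j
    simp only [mem_map, mem_bucket, Fin.valEmbedding_apply, mem_Ico]
    constructor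
    · rintro ⟨a, ha, rfl⟩
      rw [Nat.div_eq_iff hk] at ha
      omega
    · intro hj
      have h2 : j / bucketLength n ℓ = i := by rw [Nat.div_eq_iff hk]; omega
      exact ⟨⟨j, lt_of_div_bucketLength hl hln (h2 ▸ i.2)⟩, h2, rfl⟩
  rw [← card_map Fin.valEmbedding, h, Nat.card_Ico]
  omega

theorem bucketLength_mul_le (n ℓ : ℕ) : (bucketLength n ℓ : ℝ) * ℓ ≤ n := by
  exact_mod_cast Nat.div_mul_le_self n ℓ

/-- The discarded remainder is less than ℓ ≤ kℓ. This lets k be replaced by n/ℓ at the cost of a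
factor 2. -/
theorem le_two_mul_bucketLength_mul {n ℓ : ℕ} (hl : 1 ≤ ℓ) (hln : ℓ ≤ n) :
    (n : ℝ) ≤ 2 * (bucketLength n ℓ * ℓ) := by
  have h1 := Nat.div_add_mod n ℓ
  have h2 := Nat.mod_lt n hl
  have h3 := bucketLength_pos hl hln
  have h4 : n ≤ 2 * (bucketLength n ℓ * ℓ) := by
    unfold bucketLength at *
    nlinarith [Nat.mul_le_mul_right ℓ h3]
  exact_mod_cast h4

/-! ### Label means -/

/-- The mean of the labels `s` over a bucket. -/
noncomputable def labelMean {n : ℕ} (ℓ : ℕ) (s : Fin n → ℤˣ) (i : Fin ℓ) : ℝ :=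
  bucketMean ℓ (fun j => (((s j : ℤˣ) : ℤ) : ℝ)) i

theorem abs_intUnits (u : ℤˣ) : |((u : ℤ) : ℝ)| = 1 := by
  rcases Int.units_eq_one_or u with rfl | rfl <;> simp

theorem labelMean_sq_le_one {n ℓ : ℕ} (hl : 1 ≤ ℓ) (hln : ℓ ≤ n) (s : Fin n → ℤˣ) (i : Fin ℓ) :
    labelMean ℓ s i ^ 2 ≤ 1 := by
  have hk : (0 : ℝ) < bucketLength n ℓ := by exact_mod_cast bucketLength_pos hl hln
  rw [sq_le_one_iff_abs_le_one, labelMean, bucketMean_def, smul_eq_mul, abs_mul,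
    abs_of_pos (by positivity), one_div, inv_mul_le_iff₀ hk, mul_one]
  refine (abs_sum_le_sum_abs _ _).trans ?_
  simp [abs_intUnits, card_bucket hl hln]

/-- The flips of a label path; the last entry is the last label. -/
def labelFlip {n : ℕ} (s : Fin n → ℤˣ) (j : Fin n) : ℤˣ :=
  if h : j.val + 1 < n then s ⟨j.val + 1, h⟩ * s j else s j

/-- The path with given flips. -/
def labelPath {n : ℕ} (r : Fin n → ℤˣ) (j : Fin n) : ℤˣ := ∏ t ∈ Ici j, r t

theorem labelFlip_labelPath {n : ℕ} (r : Fin n → ℤˣ) : labelFlip (labelPath r) = r := by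
  funext j
  unfold labelFlip labelPath
  split_ifs with h
  · have h1 : Ici j = insert j (Ici (⟨j.val + 1, h⟩ : Fin n)) := by
      ext a
      simp only [mem_Ici, mem_insert, Fin.le_def, Fin.ext_iff]
      omega
    rw [h1, prod_insert (by simp [Fin.le_def]), mul_left_comm, Int.units_mul_self, mul_one]
  · have h1 : Ici j = {j} := by
      ext a
      simp only [mem_Ici, mem_singleton, Fin.le_def, Fin.ext_iff]
      omega
    rw [h1, prod_singleton]

theorem labelPath_labelFlip {n : ℕ} (s : Fin n → ℤˣ) : labelPath (labelFlip s) = s := by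
  have hsurj : Function.Surjective (labelFlip (n := n)) := fun r => ⟨labelPath r, labelFlip_labelPath r⟩
  exact (Finite.injective_iff_surjective.2 hsurj) (labelFlip_labelPath _)

/-- The weight of one labelFlip. -/
noncomputable def flipWeight (n : ℕ) (δ : ℝ) (j : Fin n) (r : ℤˣ) : ℝ :=
  if j.val + 1 < n then (if r = 1 then 1 - δ else δ) else 1 / 2

/-- In the coordinates given by the flips and the last label the chain is a product law. The factor
1/2 of the initial label is attached to the last one instead. -/
theorem chainProb_eq_prod_flipWeight {n : ℕ} (hn : 1 ≤ n) (δ : ℝ) (s : Fin n → ℤˣ) :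
    chainProb δ s = ∏ j, flipWeight n δ j (labelFlip s j) := by
  have h1 : ∀ j : Fin n, flipWeight n δ j (labelFlip s j) =
      (if j.val + 1 < n then 1 else 1 / 2) *
      if h : j.val + 1 < n then (if s ⟨j.val + 1, h⟩ = s j then 1 - δ else δ) else 1 := by
    intro j
    unfold flipWeight labelFlip
    split_ifs with h h2 h3 h3
    · rw [one_mul]
    · exact absurd (by rw [mul_eq_one_iff_eq_inv.1 h2, Int.units_inv_eq_self]) h3
    · exact absurd (by rw [h3, Int.units_mul_self]) h2
    · rw [one_mul]
    · rw [mul_one]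
  simp only [h1, prod_mul_distrib]
  rw [chainProb, prod_eq_single (f := fun j : Fin n => if j.val + 1 < n then (1 : ℝ) else 1 / 2)
    (⟨n - 1, by omega⟩ : Fin n)]
  · simp [show ¬ (n - 1 + 1 < n) by omega]
  · intro j _ hj
    rw [if_pos]
    simp only [ne_eq, Fin.ext_iff] at hj
    omega
  · simp

/-- Telescoping: the labels after j' occur in both tail products and cancel. -/
theorem mul_eq_prod_labelFlip {n : ℕ} (s : Fin n → ℤˣ) {j j' : Fin n} (h : j ≤ j') :
    s j * s j' = ∏ t ∈ Ico j j', labelFlip s t := by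
  nth_rewrite 1 2 [← labelPath_labelFlip s]
  unfold labelPath
  have h1 : Ici j = Ico j j' ∪ Ici j' := by
    ext a
    simp only [mem_Ici, mem_union, mem_Ico, Fin.le_def, Fin.lt_def] at h ⊢
    omega
  have h2 : Disjoint (Ico j j') (Ici j') := by
    rw [Finset.disjoint_left]
    intro a ha hb
    simp only [mem_Ico, mem_Ici] at ha hb
    exact absurd ha.2 (not_lt.2 hb)
  rw [h1, prod_union h2, mul_assoc, Int.units_mul_self, mul_one]

/-- The indices of the flips inside a bucket. -/
def innerBucket (n ℓ i : ℕ) : Finset (Fin n) :=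
  univ.filter fun t => t.val / bucketLength n ℓ = i ∧ (t.val + 1) / bucketLength n ℓ = i

theorem innerBucket_subset (n ℓ i : ℕ) : innerBucket n ℓ i ⊆ bucket n ℓ i := fun t ht => by
  simp only [innerBucket, mem_filter] at ht
  exact mem_bucket.2 ht.2.1

/-- The squared label mean of a bucket as a function of the flips. -/
noncomputable def flipSq (n ℓ i : ℕ) (r : Fin n → ℤˣ) : ℝ :=
  (1 / (bucketLength n ℓ : ℝ)) ^ 2 * ∑ j ∈ bucket n ℓ i, ∑ j' ∈ bucket n ℓ i,
    (((∏ t ∈ Ico (min j j') (max j j'), r t : ℤˣ) : ℤ) : ℝ)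

theorem labelMean_sq_eq_flipSq {n ℓ : ℕ} (s : Fin n → ℤˣ) (i : Fin ℓ) :
    labelMean ℓ s i ^ 2 = flipSq n ℓ i (labelFlip s) := by
  rw [labelMean, bucketMean_def, flipSq, smul_eq_mul, mul_pow, sq (∑ j ∈ _, _), sum_mul_sum]
  congr 1
  refine sum_congr rfl fun j _ => sum_congr rfl fun j' _ => ?_
  rw [← mul_eq_prod_labelFlip s min_le_max]
  rcases le_total j j' with h | h <;> simp [h, mul_comm]

theorem Ico_subset_innerBucket {n ℓ i : ℕ} {j j' : Fin n}
    (hj : j ∈ bucket n ℓ i) (hj' : j' ∈ bucket n ℓ i) :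
    Ico (min j j') (max j j') ⊆ innerBucket n ℓ i := by
  intro t ht
  rw [mem_Ico] at ht
  have h1 : min j j' ∈ bucket n ℓ i := by rcases min_choice j j' with h | h <;> rwa [h]
  have h2 : max j j' ∈ bucket n ℓ i := by rcases max_choice j j' with h | h <;> rwa [h]
  rw [mem_bucket] at h1 h2
  have h3 : t.val / bucketLength n ℓ ≤ i := h2 ▸ Nat.div_le_div_right ht.2.le
  have h4 : i ≤ t.val / bucketLength n ℓ := h1 ▸ Nat.div_le_div_right ht.1
  have h5 : (t.val + 1) / bucketLength n ℓ ≤ i := h2 ▸ Nat.div_le_div_right ht.2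
  have h6 : i ≤ (t.val + 1) / bucketLength n ℓ := h4.trans (Nat.div_le_div_right (by omega))
  simp only [innerBucket, mem_filter, mem_univ, true_and]
  omega

/-- Squaring removes the common sign of the bucket, so only the flips between two of its own indices
matter. These sets of flips are disjoint for different buckets. -/
theorem flipSq_congr {n ℓ i : ℕ} {r r' : Fin n → ℤˣ}
    (h : ∀ t ∈ innerBucket n ℓ i, r t = r' t) : flipSq n ℓ i r = flipSq n ℓ i r' := by
  unfold flipSq
  congr 1
  refine sum_congr rfl fun j hj => sum_congr rfl fun j' hj' => ?_
  rw [prod_congr rfl fun t ht => h t (Ico_subset_innerBucket hj hj' ht)]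

theorem flipSq_eq_one {n ℓ : ℕ} (hl : 1 ≤ ℓ) (hln : ℓ ≤ n) (i : Fin ℓ) {r : Fin n → ℤˣ}
    (h : ∀ t ∈ innerBucket n ℓ i, r t = 1) : flipSq n ℓ i r = 1 := by
  rw [flipSq_congr (r' := fun _ => 1) h, flipSq]
  have hk : (bucketLength n ℓ : ℝ) ≠ 0 := by exact_mod_cast (bucketLength_pos hl hln).ne'
  simp [card_bucket hl hln]
  field_simp

/-- The squared label mean as a function of the flips inside the bucket. -/
noncomputable def innerSq (n ℓ i : ℕ) (x : innerBucket n ℓ i → ℤˣ) : ℝ :=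
  flipSq n ℓ i fun t => if h : t ∈ innerBucket n ℓ i then x ⟨t, h⟩ else 1

theorem labelMean_sq_eq_innerSq {n ℓ : ℕ} (s : Fin n → ℤˣ) (i : Fin ℓ) :
    labelMean ℓ s i ^ 2 = innerSq n ℓ i fun t => labelFlip s t := by
  rw [labelMean_sq_eq_flipSq, innerSq]
  exact flipSq_congr fun t ht => by rw [dif_pos ht]

/-! ### The law of the flips -/

theorem flipWeight_nonneg {n : ℕ} {δ : ℝ} (h0 : 0 ≤ δ) (h1 : δ ≤ 1) (j : Fin n) (r : ℤˣ) :
    0 ≤ flipWeight n δ j r := by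
  unfold flipWeight
  split_ifs <;> linarith

theorem flipWeight_one_add {n : ℕ} (δ : ℝ) (j : Fin n) :
    flipWeight n δ j 1 + flipWeight n δ j (-1) = 1 := by
  unfold flipWeight
  split_ifs with h h1 h2 h3
  · exact absurd h2 (by decide)
  · ring
  · exact absurd rfl h1
  · exact absurd rfl h1
  · norm_num

/-- The law of one flip. -/
noncomputable def flipLaw (n : ℕ) (δ : ℝ) (j : Fin n) : Measure ℤˣ :=
  ENNReal.ofReal (flipWeight n δ j 1) • Measure.dirac 1 +
    ENNReal.ofReal (flipWeight n δ j (-1)) • Measure.dirac (-1)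

theorem flipLaw_singleton (n : ℕ) (δ : ℝ) (j : Fin n) (r : ℤˣ) :
    flipLaw n δ j {r} = ENNReal.ofReal (flipWeight n δ j r) := by
  rcases Int.units_eq_one_or r with rfl | rfl
  · simp [flipLaw, Set.indicator, show (-1 : ℤˣ) ≠ 1 by decide]
  · simp [flipLaw, Set.indicator, show (1 : ℤˣ) ≠ -1 by decide]

theorem isProbabilityMeasure_flipLaw {n : ℕ} {δ : ℝ} (h0 : 0 ≤ δ) (h1 : δ ≤ 1) (j : Fin n) :
    IsProbabilityMeasure (flipLaw n δ j) := ⟨by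
  simp only [flipLaw, Measure.coe_add, Measure.coe_smul, Pi.add_apply, Pi.smul_apply,
    measure_univ, smul_eq_mul, mul_one]
  rw [← ENNReal.ofReal_add (flipWeight_nonneg h0 h1 j _) (flipWeight_nonneg h0 h1 j _),
    flipWeight_one_add, ENNReal.ofReal_one]⟩

section LabelChain

variable {Ω : Type*} [MeasurableSpace Ω] {μ : Measure Ω} [IsProbabilityMeasure μ] {n : ℕ} {δ : ℝ}
  {η : Fin n → Ω → ℤˣ}

theorem measurable_labelFlip (hη : ∀ i, Measurable (η i)) (j : Fin n) :
    Measurable fun ω => labelFlip (fun i => η i ω) j :=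
  (Measurable.of_discrete (f := fun s : Fin n → ℤˣ => labelFlip s j)).comp
    (measurable_pi_lambda _ hη)

theorem map_labelFlip (hn : 1 ≤ n) (h0 : 0 ≤ δ) (h1 : δ ≤ 1) (hη : ∀ i, Measurable (η i))
    (hlaw : ∀ s : Fin n → ℤˣ, μ.real {ω | ∀ i, η i ω = s i} = chainProb δ s) :
    μ.map (fun ω j => labelFlip (fun i => η i ω) j) = Measure.pi (flipLaw n δ) := by
  have := fun j => isProbabilityMeasure_flipLaw (n := n) h0 h1 j
  refine Measure.ext_of_singleton fun r => ?_
  rw [Measure.pi_singleton,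
    Measure.map_apply (measurable_pi_lambda _ (measurable_labelFlip hη)) (MeasurableSet.singleton r)]
  simp only [flipLaw_singleton]
  rw [← ENNReal.ofReal_prod_of_nonneg fun j _ => flipWeight_nonneg h0 h1 j _]
  have h2 : (fun ω j => labelFlip (fun i => η i ω) j) ⁻¹' {r} =
      {ω | ∀ i, η i ω = labelPath r i} := by
    ext ω
    simp only [Set.mem_preimage, Set.mem_singleton_iff, Set.mem_ofPred_eq, ← funext_iff]
    constructor
    · intro h
      rw [← h]
      exact (labelPath_labelFlip _).symm
    · intro h
      rw [h]
      exact labelFlip_labelPath r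
  rw [h2, ← ofReal_measureReal, hlaw, chainProb_eq_prod_flipWeight hn, labelFlip_labelPath]

theorem map_labelFlip_apply (hn : 1 ≤ n) (h0 : 0 ≤ δ) (h1 : δ ≤ 1) (hη : ∀ i, Measurable (η i))
    (hlaw : ∀ s : Fin n → ℤˣ, μ.real {ω | ∀ i, η i ω = s i} = chainProb δ s) (j : Fin n) :
    μ.map (fun ω => labelFlip (fun i => η i ω) j) = flipLaw n δ j := by
  have := fun j => isProbabilityMeasure_flipLaw (n := n) h0 h1 j
  rw [← (measurePreserving_eval (flipLaw n δ) j).map_eq, ← map_labelFlip hn h0 h1 hη hlaw,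
    Measure.map_map (measurable_pi_apply j) (measurable_pi_lambda _ (measurable_labelFlip hη))]
  rfl

theorem iIndepFun_labelFlip (hn : 1 ≤ n) (h0 : 0 ≤ δ) (h1 : δ ≤ 1) (hη : ∀ i, Measurable (η i))
    (hlaw : ∀ s : Fin n → ℤˣ, μ.real {ω | ∀ i, η i ω = s i} = chainProb δ s) :
    iIndepFun (fun j ω => labelFlip (fun i => η i ω) j) μ := by
  rw [iIndepFun_iff_map_fun_eq_pi_map fun j => (measurable_labelFlip hη j).aemeasurable,
    map_labelFlip hn h0 h1 hη hlaw]
  simp only [map_labelFlip_apply hn h0 h1 hη hlaw]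

theorem measureReal_labelFlip_eq (hn : 1 ≤ n) (h0 : 0 ≤ δ) (h1 : δ ≤ 1)
    (hη : ∀ i, Measurable (η i))
    (hlaw : ∀ s : Fin n → ℤˣ, μ.real {ω | ∀ i, η i ω = s i} = chainProb δ s) (j : Fin n) (r : ℤˣ) :
    μ.real {ω | labelFlip (fun i => η i ω) j = r} = flipWeight n δ j r := by
  have h := map_labelFlip_apply hn h0 h1 hη hlaw j
  have h2 : μ.map (fun ω => labelFlip (fun i => η i ω) j) {r} =
      ENNReal.ofReal (flipWeight n δ j r) := by rw [h, flipLaw_singleton]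
  rw [Measure.map_apply (measurable_labelFlip hη j) (MeasurableSet.singleton r)] at h2
  rw [measureReal_def]
  change (μ ((fun ω => labelFlip (fun i => η i ω) j) ⁻¹' {r})).toReal = _
  rw [h2, ENNReal.toReal_ofReal (flipWeight_nonneg h0 h1 j r)]

/-! ### Concentration of the label energy -/

theorem measurable_labelMean_sq (hη : ∀ i, Measurable (η i)) {ℓ : ℕ} (i : Fin ℓ) :
    Measurable fun ω => labelMean ℓ (fun j => η j ω) i ^ 2 :=
  (Measurable.of_discrete (f := fun s : Fin n → ℤˣ => labelMean ℓ s i ^ 2)).comp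
    (measurable_pi_lambda _ hη)

theorem iIndepFun_labelMean_sq (hn : 1 ≤ n) (h0 : 0 ≤ δ) (h1 : δ ≤ 1) (hη : ∀ i, Measurable (η i))
    (hlaw : ∀ s : Fin n → ℤˣ, μ.real {ω | ∀ i, η i ω = s i} = chainProb δ s) (ℓ : ℕ) :
    iIndepFun (fun (i : Fin ℓ) ω => labelMean ℓ (fun j => η j ω) i ^ 2) μ := by
  have h := iIndepFun_blocks (iIndepFun_labelFlip hn h0 h1 hη hlaw) (measurable_labelFlip hη)
    (fun i : Fin ℓ => innerBucket n ℓ i) fun a b hab =>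
      (disjoint_bucket fun h => hab (Fin.ext h)).mono (innerBucket_subset n ℓ a)
        (innerBucket_subset n ℓ b)
  have h2 := h.comp (fun i => innerSq n ℓ i) fun i => Measurable.of_discrete
  refine h2.congr fun i => Filter.Eventually.of_forall fun ω => ?_
  simp only [Function.comp, labelMean_sq_eq_innerSq]

theorem integrable_labelMean_sq (hη : ∀ i, Measurable (η i)) {ℓ : ℕ} (hl : 1 ≤ ℓ) (hln : ℓ ≤ n)
    (i : Fin ℓ) : Integrable (fun ω => labelMean ℓ (fun j => η j ω) i ^ 2) μ :=
  Integrable.of_bound (measurable_labelMean_sq hη i).aestronglyMeasurable 1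
    (Filter.Eventually.of_forall fun ω => by
      rw [Real.norm_eq_abs, abs_of_nonneg (sq_nonneg _)]
      exact labelMean_sq_le_one hl hln _ i)

theorem labelEnergy_eq_sum_integral (hη : ∀ i, Measurable (η i))
    (hlaw : ∀ s : Fin n → ℤˣ, μ.real {ω | ∀ i, η i ω = s i} = chainProb δ s) {ℓ : ℕ}
    (hl : 1 ≤ ℓ) (hln : ℓ ≤ n) :
    labelEnergy n δ ℓ = ∑ i : Fin ℓ, ∫ ω, labelMean ℓ (fun j => η j ω) i ^ 2 ∂μ := by
  rw [← integral_finsetSum _ fun i _ => integrable_labelMean_sq hη hl hln i]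
  have hm : Measurable fun ω j => η j ω := measurable_pi_lambda _ hη
  rw [← integral_map (f := fun s : Fin n → ℤˣ => ∑ i : Fin ℓ, labelMean ℓ s i ^ 2)
    (φ := fun ω j => η j ω) hm.aemeasurable
    (Measurable.of_discrete).aestronglyMeasurable]
  have := Measure.isProbabilityMeasure_map (μ := μ) hm.aemeasurable
  rw [integral_fintype Integrable.of_finite]
  refine sum_congr rfl fun s _ => ?_
  rw [map_measureReal_apply hm (MeasurableSet.singleton s), smul_eq_mul, ← hlaw]
  congr 2
  ext ω
  simp [funext_iff]

theorem card_innerBucket_le {ℓ : ℕ} (hl : 1 ≤ ℓ) (hln : ℓ ≤ n) (i : Fin ℓ) :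
    #(innerBucket n ℓ i) ≤ bucketLength n ℓ :=
  (card_le_card (innerBucket_subset n ℓ i)).trans_eq (card_bucket hl hln i)

theorem val_add_one_lt_of_mem_innerBucket {ℓ : ℕ} (hl : 1 ≤ ℓ) (hln : ℓ ≤ n) {i : Fin ℓ}
    {t : Fin n} (ht : t ∈ innerBucket n ℓ i) : t.val + 1 < n := by
  simp only [innerBucket, mem_filter] at ht
  exact lt_of_div_bucketLength hl hln (ht.2.2 ▸ i.2)

theorem labelMean_sq_eq_one {ℓ : ℕ} (hl : 1 ≤ ℓ) (hln : ℓ ≤ n) (i : Fin ℓ) {s : Fin n → ℤˣ}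
    (h : ∀ t ∈ innerBucket n ℓ i, labelFlip s t = 1) : labelMean ℓ s i ^ 2 = 1 := by
  rw [labelMean_sq_eq_flipSq, flipSq_eq_one hl hln i h]

/-- Without a flip inside the bucket the squared mean is 1; a union bound over at most k flips does
the rest. It controls the total variance in the deviation bound. -/
theorem one_sub_le_integral_labelMean_sq (h0 : 0 ≤ δ) (h1 : δ ≤ 1) (hη : ∀ i, Measurable (η i))
    (hlaw : ∀ s : Fin n → ℤˣ, μ.real {ω | ∀ i, η i ω = s i} = chainProb δ s) {ℓ : ℕ}
    (hl : 1 ≤ ℓ) (hln : ℓ ≤ n) (i : Fin ℓ) :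
    1 - bucketLength n ℓ * δ ≤ ∫ ω, labelMean ℓ (fun j => η j ω) i ^ 2 ∂μ := by
  have hn := hl.trans hln
  let A : Set Ω := ⋃ t ∈ innerBucket n ℓ i, {ω | labelFlip (fun j => η j ω) t = -1}
  have hAm : MeasurableSet A := Finset.measurableSet_biUnion _ fun t _ =>
    measurable_labelFlip hη t (MeasurableSet.singleton (-1))
  have hA : μ.real A ≤ bucketLength n ℓ * δ := by
    refine (measureReal_biUnion_finset_le _ _).trans ?_
    rw [sum_congr rfl fun t ht => (measureReal_labelFlip_eq hn h0 h1 hη hlaw t (-1)).trans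
      (show flipWeight n δ t (-1) = δ by
        rw [flipWeight, if_pos (val_add_one_lt_of_mem_innerBucket hl hln ht), if_neg (by decide)])]
    rw [sum_const, nsmul_eq_mul]
    exact mul_le_mul_of_nonneg_right (by exact_mod_cast card_innerBucket_le hl hln i) h0
  have hind : ∫ ω, (1 - A.indicator (fun _ => (1 : ℝ)) ω) ∂μ = 1 - μ.real A := by
    rw [integral_sub (integrable_const _) ((integrable_const _).indicator hAm),
      integral_indicator hAm]
    simp
  calc 1 - bucketLength n ℓ * δ ≤ 1 - μ.real A := by linarith
    _ = _ := hind.symm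
    _ ≤ _ := by
      refine integral_mono ((integrable_const _).sub ((integrable_const _).indicator hAm))
        (integrable_labelMean_sq hη hl hln i) fun ω => ?_
      by_cases hω : ω ∈ A
      · simp only [Set.indicator_of_mem hω, sub_self]
        exact sq_nonneg _
      · simp only [Set.indicator_of_notMem hω, sub_zero]
        refine (labelMean_sq_eq_one hl hln i fun t ht => ?_).ge
        refine (Int.units_eq_one_or _).resolve_right fun h => hω ?_
        exact Set.mem_biUnion ht h

/-- The right event is again the absence of inner flips, but its probability is now computed exactly
from independence. This stays bounded below for kδ ≤ 1, where 1 - kδ may vanish. -/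
theorem one_sub_pow_le_integral_labelMean_sq (h0 : 0 ≤ δ) (h1 : δ ≤ 1)
    (hη : ∀ i, Measurable (η i))
    (hlaw : ∀ s : Fin n → ℤˣ, μ.real {ω | ∀ i, η i ω = s i} = chainProb δ s) {ℓ : ℕ}
    (hl : 1 ≤ ℓ) (hln : ℓ ≤ n) (i : Fin ℓ) :
    (1 - δ) ^ bucketLength n ℓ ≤ ∫ ω, labelMean ℓ (fun j => η j ω) i ^ 2 ∂μ := by
  have hn := hl.trans hln
  let A : Set Ω := ⋂ t ∈ innerBucket n ℓ i, (fun ω => labelFlip (fun j => η j ω) t) ⁻¹' {1}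
  have hAm : MeasurableSet A := Finset.measurableSet_biInter _ fun t _ =>
    measurable_labelFlip hη t (MeasurableSet.singleton 1)
  have hA : μ.real A = (1 - δ) ^ #(innerBucket n ℓ i) := by
    have h := (iIndepFun_labelFlip hn h0 h1 hη hlaw).measure_inter_preimage_eq_mul
      (innerBucket n ℓ i) (sets := fun _ => {1}) fun _ _ => MeasurableSet.singleton 1
    rw [measureReal_def, h, ENNReal.toReal_prod, ← prod_const]
    refine prod_congr rfl fun t ht => ?_
    refine (measureReal_labelFlip_eq hn h0 h1 hη hlaw t 1).trans ?_
    rw [flipWeight, if_pos (val_add_one_lt_of_mem_innerBucket hl hln ht), if_pos rfl]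
  calc (1 - δ) ^ bucketLength n ℓ ≤ (1 - δ) ^ #(innerBucket n ℓ i) :=
        pow_le_pow_of_le_one (by linarith) (by linarith) (card_innerBucket_le hl hln i)
    _ = ∫ ω, A.indicator (fun _ => (1 : ℝ)) ω ∂μ := by
        rw [← hA, integral_indicator hAm]; simp
    _ ≤ _ := by
      refine integral_mono ((integrable_const _).indicator hAm)
        (integrable_labelMean_sq hη hl hln i) fun ω => ?_
      by_cases hω : ω ∈ A
      · simp only [Set.indicator_of_mem hω]
        exact (labelMean_sq_eq_one hl hln i fun t ht => Set.mem_iInter₂.1 hω t ht).ge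
      · simp only [Set.indicator_of_notMem hω]
        exact sq_nonneg _

theorem one_eighth_le_one_sub_pow {δ : ℝ} (h0 : 0 ≤ δ) (h1 : δ ≤ 1 / 2) {k : ℕ}
    (hk : (k : ℝ) * δ ≤ 1) : 1 / 8 ≤ (1 - δ) ^ k := by
  have h2 : Real.exp (-(2 * δ)) ≤ 1 - δ := by
    have h3 : 1 + 2 * δ + (2 * δ) ^ 2 / 2 ≤ Real.exp (2 * δ) :=
      Real.quadratic_le_exp_of_nonneg (by linarith)
    rw [Real.exp_neg, inv_le_comm₀ (Real.exp_pos _) (by linarith), inv_le_iff_one_le_mul₀ (by linarith)]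
    nlinarith [mul_nonneg h0 h0, mul_nonneg (mul_nonneg h0 h0) h0]
  calc (1 : ℝ) / 8 ≤ Real.exp (-2) := by
        have h4 : Real.exp 2 ≤ 8 := by
          have : Real.exp 2 = Real.exp 1 ^ 2 := by rw [← Real.exp_nat_mul]; norm_num
          rw [this]
          have := Real.exp_one_lt_d9
          nlinarith [Real.exp_pos 1]
        rw [Real.exp_neg, ← one_div]
        exact one_div_le_one_div_of_le (Real.exp_pos _) h4
    _ ≤ Real.exp (k * -(2 * δ)) := Real.exp_le_exp.2 (by nlinarith)
    _ = Real.exp (-(2 * δ)) ^ k := Real.exp_nat_mul _ _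
    _ ≤ _ := pow_le_pow_left₀ (Real.exp_pos _).le h2 k

theorem labelEnergy_le (hη : ∀ i, Measurable (η i))
    (hlaw : ∀ s : Fin n → ℤˣ, μ.real {ω | ∀ i, η i ω = s i} = chainProb δ s) {ℓ : ℕ}
    (hl : 1 ≤ ℓ) (hln : ℓ ≤ n) : labelEnergy n δ ℓ ≤ ℓ := by
  rw [labelEnergy_eq_sum_integral hη hlaw hl hln]
  refine (sum_le_card_nsmul univ _ 1 fun i _ => ?_).trans (by simp)
  refine (integral_mono (integrable_labelMean_sq hη hl hln i) (integrable_const 1)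
    fun ω => labelMean_sq_le_one hl hln _ i).trans (by simp)

theorem le_labelEnergy (h0 : 0 ≤ δ) (h1 : δ ≤ 1 / 2) (hη : ∀ i, Measurable (η i))
    (hlaw : ∀ s : Fin n → ℤˣ, μ.real {ω | ∀ i, η i ω = s i} = chainProb δ s) {ℓ : ℕ}
    (hl : 1 ≤ ℓ) (hln : ℓ ≤ n) (hδ : (bucketLength n ℓ : ℝ) * δ ≤ 1) :
    (ℓ : ℝ) / 8 ≤ labelEnergy n δ ℓ := by
  rw [labelEnergy_eq_sum_integral hη hlaw hl hln]
  refine le_trans ?_ (card_nsmul_le_sum univ _ (1 / 8) fun i _ =>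
    (one_eighth_le_one_sub_pow h0 h1 hδ).trans
      (one_sub_pow_le_integral_labelMean_sq h0 (by linarith) hη hlaw hl hln i))
  simp [div_eq_mul_inv]

theorem measureReal_sum_labelMean_sq_le (h0 : 0 ≤ δ) (h1 : δ ≤ 1 / 2) (hη : ∀ i, Measurable (η i))
    (hlaw : ∀ s : Fin n → ℤˣ, μ.real {ω | ∀ i, η i ω = s i} = chainProb δ s) {ℓ : ℕ}
    (hl : 1 ≤ ℓ) (hln : ℓ ≤ n) (hδ : (bucketLength n ℓ : ℝ) * δ ≤ 1) :
    μ.real {ω | ∑ i : Fin ℓ, labelMean ℓ (fun j => η j ω) i ^ 2 ≤ labelEnergy n δ ℓ / 2} ≤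
      Real.exp (-(ℓ / 128)) := by
  -- With t = -1/4 and s = E/8 the event is that the sum is at most E/2, and the exponent is E/16 -
  -- E/8 = -E/16 ≤ -ℓ/128.
  have h := measureReal_sum_mul_ge_le_of_mem_Icc (μ := μ)
    (iIndepFun_labelMean_sq (hl.trans hln) h0 (by linarith) hη hlaw ℓ)
    (measurable_labelMean_sq hη) (fun i ω => sq_nonneg _)
    (fun i ω => labelMean_sq_le_one hl hln _ i) (t := -(1 / 4)) (by norm_num [abs_of_neg])
    (labelEnergy n δ ℓ / 8)
  rw [← labelEnergy_eq_sum_integral hη hlaw hl hln] at h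
  have hE := le_labelEnergy h0 h1 hη hlaw hl hln hδ
  refine (measureReal_mono fun ω hω => ?_).trans (h.trans (Real.exp_le_exp.2 (by linarith)))
  simp only [Set.mem_ofPred_eq] at hω ⊢
  linarith

/-- The Bernstein bound is applied to 1 minus the squared means: their expectations add up to at
most nδ, whereas those of the squares themselves can be of order ℓ. -/
theorem measureReal_abs_sum_labelMean_sq_sub_ge_le (h0 : 0 < δ) (h1 : δ ≤ 1)
    (hη : ∀ i, Measurable (η i))
    (hlaw : ∀ s : Fin n → ℤˣ, μ.real {ω | ∀ i, η i ω = s i} = chainProb δ s) {d ℓ : ℕ}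
    (hd : 1 ≤ d) (hl : 1 ≤ ℓ) (hln : ℓ ≤ n) :
    μ.real {ω | 2 * (Real.sqrt (n * δ * d) + d) ≤
      |∑ i : Fin ℓ, labelMean ℓ (fun j => η j ω) i ^ 2 - labelEnergy n δ ℓ|} ≤
      2 * Real.exp (-(d : ℝ)) := by
  have hn := hl.trans hln
  have hd0 : (0 : ℝ) < d := by exact_mod_cast hd
  have hn0 : (0 : ℝ) < n := by exact_mod_cast hn
  set E := labelEnergy n δ ℓ with hEdef
  have hE : E = _ := labelEnergy_eq_sum_integral hη hlaw hl hln
  have hV : ∑ i : Fin ℓ, ∫ ω, (1 - labelMean ℓ (fun j => η j ω) i ^ 2) ∂μ = ℓ - E := by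
    rw [hE, sum_congr rfl fun i _ =>
      integral_sub (integrable_const 1) (integrable_labelMean_sq hη hl hln i)]
    simp
  have hVn : ℓ - E ≤ n * δ := by
    have : ∑ i : Fin ℓ, (1 - (bucketLength n ℓ : ℝ) * δ) ≤ E := by
      rw [hE]
      exact sum_le_sum fun i _ => one_sub_le_integral_labelMean_sq h0.le h1 hη hlaw hl hln i
    simp only [sum_const, card_univ, Fintype.card_fin, nsmul_eq_mul] at this
    have := mul_le_mul_of_nonneg_right (bucketLength_mul_le n ℓ) h0.le
    linarith
  -- Replacing the variance proxy nδ by max(nδ, d) keeps t = √(d/v) at most 1; then t²·variance ≤ d,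
  -- and s = 2d leaves e^(-d).
  set v : ℝ := max (n * δ) d with hv
  have hv0 : 0 < v := lt_max_of_lt_right hd0
  set t : ℝ := Real.sqrt (d / v) with ht
  have ht2 : t ^ 2 = d / v := Real.sq_sqrt (by positivity)
  have ht1 : |t| ≤ 1 := by
    rw [abs_of_nonneg (Real.sqrt_nonneg _)]
    exact Real.sqrt_le_one.2 ((div_le_one hv0).2 (le_max_right _ _))
  have hts : d ≤ t * (Real.sqrt (n * δ * d) + d) := by
    rcases le_total (n * δ) d with h | h
    · have hvd : v = d := max_eq_right h
      have : t = 1 := by rw [ht, hvd, div_self hd0.ne', Real.sqrt_one]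
      rw [this, one_mul]
      linarith [Real.sqrt_nonneg (n * δ * d)]
    · have hvd : v = n * δ := max_eq_left h
      have : t * Real.sqrt (n * δ * d) = d := by
        rw [ht, hvd, ← Real.sqrt_mul (by positivity)]
        have : (d : ℝ) / (n * δ) * (n * δ * d) = d ^ 2 := by field_simp
        rw [this, Real.sqrt_sq hd0.le]
      have : 0 ≤ t * d := mul_nonneg (Real.sqrt_nonneg _) hd0.le
      linarith
  have htV : t ^ 2 * (ℓ - E) ≤ d := by
    rw [ht2, div_mul_eq_mul_div, div_le_iff₀ hv0]
    exact mul_le_mul_of_nonneg_left (hVn.trans (le_max_left _ _)) hd0.le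
  have hind : iIndepFun (fun (i : Fin ℓ) ω => 1 - labelMean ℓ (fun j => η j ω) i ^ 2) μ :=
    (iIndepFun_labelMean_sq hn h0.le h1 hη hlaw ℓ).comp (fun _ x => 1 - x) fun _ => by fun_prop
  have key : ∀ u : ℝ, |u| ≤ 1 → u ^ 2 = t ^ 2 →
      μ.real {ω | u * (ℓ - E) + 2 * d ≤
        u * ∑ i : Fin ℓ, (1 - labelMean ℓ (fun j => η j ω) i ^ 2)} ≤ Real.exp (-(d : ℝ)) := by
    intro u hu hut
    have h := measureReal_sum_mul_ge_le_of_mem_Icc (μ := μ) hind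
      (fun i => (measurable_labelMean_sq hη i).const_sub 1)
      (fun i ω => sub_nonneg.2 (labelMean_sq_le_one hl hln _ i))
      (fun i ω => sub_le_self _ (sq_nonneg _)) hu (2 * d)
    rw [hV, hut] at h
    exact h.trans (Real.exp_le_exp.2 (by linarith))
  have hsub : {ω | 2 * (Real.sqrt (n * δ * d) + d) ≤
      |∑ i : Fin ℓ, labelMean ℓ (fun j => η j ω) i ^ 2 - E|} ⊆
      {ω | t * (ℓ - E) + 2 * d ≤ t * ∑ i : Fin ℓ, (1 - labelMean ℓ (fun j => η j ω) i ^ 2)} ∪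
      {ω | -t * (ℓ - E) + 2 * d ≤ -t * ∑ i : Fin ℓ, (1 - labelMean ℓ (fun j => η j ω) i ^ 2)} := by
    intro ω hω
    simp only [Set.mem_union, Set.mem_ofPred_eq, sum_sub_distrib, sum_const, card_univ,
      Fintype.card_fin, nsmul_eq_mul, mul_one] at hω ⊢
    have := mul_le_mul_of_nonneg_left hω (Real.sqrt_nonneg (d / v))
    rw [← ht] at this
    rcases abs_cases (∑ i : Fin ℓ, labelMean ℓ (fun j => η j ω) i ^ 2 - E) with ⟨h, _⟩ | ⟨h, _⟩ <;>
      rw [h] at this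
    · right; linarith
    · left; linarith
  refine (measureReal_mono hsub).trans ((measureReal_union_le _ _).trans ?_)
  have h1 := key t ht1 rfl
  have h2 := key (-t) (by rwa [abs_neg]) (by ring)
  linarith

end LabelChain

/-! ### Sub-Gaussian variables -/

theorem hasSubgaussianMGF_mono {Ω : Type*} [MeasurableSpace Ω] {μ : Measure Ω} {X : Ω → ℝ}
    {c c' : NNReal} (h : HasSubgaussianMGF X c μ) (hc : c ≤ c') : HasSubgaussianMGF X c' μ where
  integrable_exp_mul := h.integrable_exp_mul
  mgf_le t := (h.mgf_le t).trans (by gcongr)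

theorem hasSubgaussianMGF_const_mul {Ω : Type*} [MeasurableSpace Ω] {μ : Measure Ω} {X : Ω → ℝ}
    {c c' : NNReal} (h : HasSubgaussianMGF X c μ) (r : ℝ) (hc : r ^ 2 * (c : ℝ) ≤ c') :
    HasSubgaussianMGF (fun ω => r * X ω) c' μ :=
  hasSubgaussianMGF_mono (h.const_mul r) hc

/-- By eˣ ≥ 1 + x, the function exp(ct²/2) - ta is at least 1 and equals 1 at t = 0, so its
derivative -a vanishes there. -/
theorem integral_eq_zero_of_hasSubgaussianMGF {Ω : Type*} [MeasurableSpace Ω] {μ : Measure Ω}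
    [IsProbabilityMeasure μ] {X : Ω → ℝ} {c : NNReal} (h : HasSubgaussianMGF X c μ) :
    ∫ ω, X ω ∂μ = 0 := by
  set a := ∫ ω, X ω ∂μ with ha
  have h1 : ∀ t : ℝ, 1 + t * a ≤ Real.exp (c * t ^ 2 / 2) := fun t => by
    refine le_trans ?_ (h.mgf_le t)
    have h2 : ∫ ω, (1 + t * X ω) ∂μ = 1 + t * a := by
      rw [integral_add (integrable_const _) (h.integrable.const_mul t), integral_const_mul]
      simp [ha]
    rw [← h2]
    refine integral_mono ((integrable_const _).add (h.integrable.const_mul t))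
      (h.integrable_exp_mul t) fun ω => ?_
    have := Real.add_one_le_exp (t * X ω)
    simp only
    linarith
  have hd : HasDerivAt (fun t : ℝ => Real.exp (c * t ^ 2 / 2) - t * a)
      (Real.exp (c * 0 ^ 2 / 2) * (c * (2 * 0) / 2) - 1 * a) 0 := by
    refine HasDerivAt.sub (HasDerivAt.exp ?_) ((hasDerivAt_id (0 : ℝ)).mul_const a)
    refine HasDerivAt.div_const (HasDerivAt.const_mul _ ?_) 2
    simpa using hasDerivAt_pow 2 (0 : ℝ)
  have hmin : IsLocalMin (fun t : ℝ => Real.exp (c * t ^ 2 / 2) - t * a) 0 := by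
    refine Filter.Eventually.of_forall fun t => ?_
    have := h1 t
    simp
    linarith
  have := hmin.hasDerivAt_eq_zero hd
  simpa using this

/-- A bound valid for each value of an independent finitely valued variable holds overall. -/
theorem measureReal_mem_le_of_indepFun {Ω α β : Type*} [MeasurableSpace Ω] [MeasurableSpace α]
    [MeasurableSpace β] [MeasurableSingletonClass β] [Fintype β] {μ : Measure Ω}
    [IsProbabilityMeasure μ] {X : Ω → α} {Y : Ω → β} (hXY : IndepFun X Y μ) (hY : Measurable Y)
    {U : β → Set α} (hU : ∀ s, MeasurableSet (U s)) {p : ℝ} (hp : ∀ s, μ.real (X ⁻¹' U s) ≤ p) :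
    μ.real {ω | X ω ∈ U (Y ω)} ≤ p := by
  have hsub : {ω | X ω ∈ U (Y ω)} ⊆ ⋃ s ∈ (univ : Finset β), (X ⁻¹' U s ∩ Y ⁻¹' {s}) := by
    intro ω hω
    simp only [Set.mem_iUnion]
    exact ⟨Y ω, mem_univ _, hω, rfl⟩
  refine (measureReal_mono hsub (measure_ne_top _ _)).trans
    ((measureReal_biUnion_finset_le _ _).trans ?_)
  have h1 : ∀ s, μ.real (X ⁻¹' U s ∩ Y ⁻¹' {s}) ≤ p * μ.real (Y ⁻¹' {s}) := fun s => by
    rw [measureReal_def, hXY.measure_inter_preimage_eq_mul _ _ (hU s) (MeasurableSet.singleton s),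
      ENNReal.toReal_mul]
    exact mul_le_mul_of_nonneg_right (hp s) ENNReal.toReal_nonneg
  refine (sum_le_sum fun s _ => h1 s).trans_eq ?_
  have := Measure.isProbabilityMeasure_map (μ := μ) hY.aemeasurable
  rw [← mul_sum]
  simp only [← map_measureReal_apply hY (MeasurableSet.singleton _)]
  rw [sum_measureReal_singleton, coe_univ, probReal_univ, mul_one]

/-! ### Concentration of the noise in the bucket means. -/

section Noise

variable {Ω : Type*} [MeasurableSpace Ω] {μ : Measure Ω} {d n : ℕ}
  {ξ : Fin n → Ω → EuclideanSpace ℝ (Fin d)}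

theorem hasSubgaussianMGF_inner {ζ : Ω → EuclideanSpace ℝ (Fin d)}
    (h : IsIsotropicSubGaussian ζ μ) (v : EuclideanSpace ℝ (Fin d)) :
    HasSubgaussianMGF (fun ω => inner ℝ v (ζ ω)) (‖v‖₊ ^ 2) μ where
  integrable_exp_mul t := by
    simpa only [real_inner_smul_left] using (h.subGaussian (t • v)).1
  mgf_le t := by
    have := (h.subGaussian (t • v)).2
    simp only [real_inner_smul_left, norm_smul, mul_pow, Real.norm_eq_abs, sq_abs] at this
    refine this.trans_eq ?_
    congr 1
    push_cast
    ring

theorem inner_bucketMean (ℓ : ℕ) (v : EuclideanSpace ℝ (Fin d))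
    (y : Fin n → EuclideanSpace ℝ (Fin d)) (i : Fin ℓ) :
    inner ℝ v (bucketMean ℓ y i) =
      1 / (bucketLength n ℓ : ℝ) * ∑ j ∈ bucket n ℓ i, inner ℝ v (y j) := by
  rw [bucketMean_def, real_inner_smul_right, inner_sum]

theorem measurable_bucketMean (hm : ∀ j, Measurable (ξ j)) (ℓ : ℕ) (i : Fin ℓ) :
    Measurable fun ω => bucketMean ℓ (fun j => ξ j ω) i := by
  simp only [bucketMean_def]
  have h : Measurable fun ω => ∑ j ∈ bucket n ℓ i, ξ j ω :=
    Finset.measurable_fun_sum _ fun j _ => hm j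
  exact h.const_smul (1 / (bucketLength n ℓ : ℝ))

theorem iIndepFun_inner_bucketMean (hm : ∀ j, Measurable (ξ j)) (hind : iIndepFun ξ μ) (ℓ : ℕ)
    (v : EuclideanSpace ℝ (Fin d)) :
    iIndepFun (fun (i : Fin ℓ) ω => inner ℝ v (bucketMean ℓ (fun j => ξ j ω) i)) μ := by
  have h := iIndepFun_blocks hind hm (fun i : Fin ℓ => bucket n ℓ i) fun a b hab =>
    disjoint_bucket fun h => hab (Fin.ext h)
  have h2 := h.comp (fun i x => 1 / (bucketLength n ℓ : ℝ) * ∑ j, inner ℝ v (x j)) fun i => by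
    refine Measurable.const_mul (Finset.measurable_fun_sum _ fun j _ => ?_) _
    exact Measurable.inner measurable_const (measurable_pi_apply j)
  refine h2.congr fun i => Filter.Eventually.of_forall fun ω => ?_
  simp only [Function.comp, inner_bucketMean]
  rw [← Finset.sum_coe_sort (bucket n ℓ i) fun j => inner ℝ v (ξ j ω)]

theorem iIndepFun_inner (hind : iIndepFun ξ μ) (v : EuclideanSpace ℝ (Fin d)) :
    iIndepFun (fun j ω => inner ℝ v (ξ j ω)) μ :=
  hind.comp (fun _ x => inner ℝ v x) fun _ => by fun_prop

theorem hasSubgaussianMGF_inner_bucketMean (hind : iIndepFun ξ μ)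
    (hξ : ∀ j, IsIsotropicSubGaussian (ξ j) μ) {ℓ : ℕ} (hl : 1 ≤ ℓ) (hln : ℓ ≤ n)
    (v : EuclideanSpace ℝ (Fin d)) (i : Fin ℓ) :
    HasSubgaussianMGF (fun ω => inner ℝ v (bucketMean ℓ (fun j => ξ j ω) i))
      (‖v‖₊ ^ 2 / bucketLength n ℓ) μ := by
  have hk : (bucketLength n ℓ : ℝ) ≠ 0 := by exact_mod_cast (bucketLength_pos hl hln).ne'
  simp only [inner_bucketMean]
  refine hasSubgaussianMGF_const_mul (HasSubgaussianMGF.sum_of_iIndepFun (iIndepFun_inner hind v)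
    (s := bucket n ℓ i) fun j _ => hasSubgaussianMGF_inner (hξ j) v) _ (le_of_eq ?_)
  rw [sum_const, card_bucket hl hln, nsmul_eq_mul]
  push_cast
  field_simp

theorem integral_inner_bucketMean_sq [IsProbabilityMeasure μ]
    (hind : iIndepFun ξ μ)
    (hξ : ∀ j, IsIsotropicSubGaussian (ξ j) μ) {ℓ : ℕ} (hl : 1 ≤ ℓ) (hln : ℓ ≤ n)
    (v : EuclideanSpace ℝ (Fin d)) (i : Fin ℓ) :
    ∫ ω, inner ℝ v (bucketMean ℓ (fun j => ξ j ω) i) ^ 2 ∂μ = ‖v‖ ^ 2 / bucketLength n ℓ := by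
  have hk : (bucketLength n ℓ : ℝ) ≠ 0 := by exact_mod_cast (bucketLength_pos hl hln).ne'
  have hs := HasSubgaussianMGF.sum_of_iIndepFun (iIndepFun_inner hind v) (s := bucket n ℓ i)
    fun j _ => hasSubgaussianMGF_inner (hξ j) v
  have hvar : Var[∑ j ∈ bucket n ℓ i, fun ω => inner ℝ v (ξ j ω); μ] =
      bucketLength n ℓ * ‖v‖ ^ 2 := by
    rw [IndepFun.variance_sum (fun j _ => (hasSubgaussianMGF_inner (hξ j) v).memLp 2)
      fun j _ j' _ hjj => (iIndepFun_inner hind v).indepFun hjj]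
    rw [sum_congr rfl fun j _ => ?_, sum_const, card_bucket hl hln, nsmul_eq_mul]
    rw [variance_of_integral_eq_zero (hasSubgaussianMGF_inner (hξ j) v).aemeasurable
      (integral_eq_zero_of_hasSubgaussianMGF (hasSubgaussianMGF_inner (hξ j) v))]
    have := ((hξ j).isotropic v v).2
    rw [real_inner_self_eq_norm_sq] at this
    simpa only [sq] using this
  have hsum : (∑ j ∈ bucket n ℓ i, fun ω => inner ℝ v (ξ j ω)) =
      fun ω => ∑ j ∈ bucket n ℓ i, inner ℝ v (ξ j ω) := by
    ext ω; simp
  rw [hsum, variance_of_integral_eq_zero hs.aemeasurable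
    (integral_eq_zero_of_hasSubgaussianMGF hs)] at hvar
  simp only [inner_bucketMean, mul_pow]
  rw [integral_const_mul, hvar]
  field_simp

/-- The deviation of the empirical second moment of the bucket means `z` from its mean. -/
noncomputable def noiseForm {ℓ : ℕ} (k : ℝ) (z : Fin ℓ → EuclideanSpace ℝ (Fin d)) :
    EuclideanSpace ℝ (Fin d) →ₗ[ℝ] EuclideanSpace ℝ (Fin d) →ₗ[ℝ] ℝ :=
  LinearMap.mk₂ ℝ (fun x y => ∑ i, inner ℝ x (z i) * inner ℝ y (z i) - ℓ / k * inner ℝ x y)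
    (fun x x' y => by simp only [inner_add_left, add_mul, sum_add_distrib]; ring)
    (fun c x y => by
      simp only [real_inner_smul_left, mul_assoc, ← mul_sum, smul_eq_mul]; ring)
    (fun x y y' => by
      simp only [inner_add_left, inner_add_right, mul_add, sum_add_distrib]; ring)
    (fun c x y => by
      simp only [real_inner_smul_left, real_inner_smul_right, mul_left_comm _ c, ← mul_sum,
        smul_eq_mul]; ring)

theorem noiseForm_apply {ℓ : ℕ} (k : ℝ) (z : Fin ℓ → EuclideanSpace ℝ (Fin d))
    (x y : EuclideanSpace ℝ (Fin d)) : noiseForm k z x y =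
      ∑ i, inner ℝ x (z i) * inner ℝ y (z i) - ℓ / k * inner ℝ x y := rfl

theorem measureReal_abs_noiseForm_unit_ge_le [IsProbabilityMeasure μ]
    (hd : 1 ≤ d) (hm : ∀ j, Measurable (ξ j))
    (hind : iIndepFun ξ μ) (hξ : ∀ j, IsIsotropicSubGaussian (ξ j) μ) {ℓ : ℕ} (hdl : d ≤ ℓ)
    (hln : ℓ ≤ n) {v : EuclideanSpace ℝ (Fin d)} (hv : ‖v‖ = 1) :
    μ.real {ω | 144 * Real.sqrt (d * ℓ) / bucketLength n ℓ ≤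
      |noiseForm (bucketLength n ℓ) (fun i : Fin ℓ => bucketMean ℓ (fun j => ξ j ω) i) v v|} ≤
      2 * Real.exp (-5 * d) := by
  have hl := hd.trans hdl
  have hk : (0 : ℝ) < bucketLength n ℓ := by exact_mod_cast bucketLength_pos hl hln
  have hX := measureReal_abs_sum_sq_sub_one_ge_le (μ := μ) hd hdl
    (X := fun i ω => Real.sqrt (bucketLength n ℓ) * inner ℝ v (bucketMean ℓ (fun j => ξ j ω) i))
    ((iIndepFun_inner_bucketMean hm hind ℓ v).comp (fun _ x => Real.sqrt (bucketLength n ℓ) * x)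
      fun _ => by fun_prop)
    (fun i => ((measurable_bucketMean hm ℓ i).const_inner).const_mul _)
    (fun i => hasSubgaussianMGF_const_mul (hasSubgaussianMGF_inner_bucketMean hind hξ hl hln v i) _
      (le_of_eq (by
        push_cast
        rw [Real.sq_sqrt hk.le, hv]
        field_simp)))
    (fun i => by
      simp only [mul_pow, Real.sq_sqrt hk.le]
      rw [integral_const_mul, integral_inner_bucketMean_sq hind hξ hl hln v i, hv]
      field_simp)
  refine (measureReal_mono fun ω hω => ?_).trans hX
  simp only [Set.mem_ofPred_eq] at hω ⊢
  rw [div_le_iff₀ hk] at hω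
  refine hω.trans_eq ?_
  rw [← abs_of_pos hk, ← abs_mul, abs_of_pos hk, noiseForm_apply, real_inner_self_eq_norm_sq, hv]
  congr 1
  simp only [mul_pow, Real.sq_sqrt hk.le, sum_sub_distrib, ← mul_sum, sum_const, card_univ,
    Fintype.card_fin, nsmul_eq_mul, ← sq]
  field_simp

/-- Polarization reduces a pair (u, v) of net points to the quadratic form at u + v and u - v, which
the parallelogram law bounds by s. The at most 25^d pairs cost e^(4d) against e^(-5d). -/
theorem measureReal_exists_abs_noiseForm_gt_le [IsProbabilityMeasure μ]
    (hd : 1 ≤ d) (hm : ∀ j, Measurable (ξ j))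
    (hind : iIndepFun ξ μ) (hξ : ∀ j, IsIsotropicSubGaussian (ξ j) μ) {ℓ : ℕ} (hdl : d ≤ ℓ)
    (hln : ℓ ≤ n) :
    μ.real {ω | ∃ x y, 4 * (144 * Real.sqrt (d * ℓ) / bucketLength n ℓ) * ‖x‖ * ‖y‖ <
      |noiseForm (bucketLength n ℓ) (fun i : Fin ℓ => bucketMean ℓ (fun j => ξ j ω) i) x y|} ≤
      4 * Real.exp (-(d : ℝ)) := by
  obtain ⟨N, hNc, hN1, hN⟩ := exists_half_net d
  set s := 144 * Real.sqrt (d * ℓ) / bucketLength n ℓ with hs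
  have hs0 : 0 ≤ s := by positivity
  let A : EuclideanSpace ℝ (Fin d) → Set Ω := fun w => {ω | s * ‖w‖ ^ 2 <
    |noiseForm (bucketLength n ℓ) (fun i : Fin ℓ => bucketMean ℓ (fun j => ξ j ω) i) w w|}
  have hA : ∀ w, μ.real (A w) ≤ 2 * Real.exp (-5 * d) := by
    intro w
    rcases eq_or_ne w 0 with rfl | hw
    · have : A 0 = ∅ := by ext ω; simp [A]
      rw [this, measureReal_empty]
      positivity
    · have hw0 : 0 < ‖w‖ := norm_pos_iff.2 hw
      refine (measureReal_mono fun ω hω => ?_).trans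
        (measureReal_abs_noiseForm_unit_ge_le hd hm hind hξ hdl hln (v := ‖w‖⁻¹ • w)
          (by rw [norm_smul, norm_inv, norm_norm, inv_mul_cancel₀ hw0.ne']))
      simp only [A, Set.mem_ofPred_eq, map_smul, LinearMap.smul_apply, smul_eq_mul] at hω ⊢
      rw [← mul_assoc, abs_mul, abs_of_pos (by positivity : 0 < ‖w‖⁻¹ * ‖w‖⁻¹)]
      rw [← hs]
      have : s = ‖w‖⁻¹ * ‖w‖⁻¹ * (s * ‖w‖ ^ 2) := by field_simp
      rw [this]
      exact mul_le_mul_of_nonneg_left hω.le (by positivity)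
  have hsub : {ω | ∃ x y, 4 * s * ‖x‖ * ‖y‖ <
      |noiseForm (bucketLength n ℓ) (fun i : Fin ℓ => bucketMean ℓ (fun j => ξ j ω) i) x y|} ⊆
      ⋃ p ∈ N ×ˢ N, (A (p.1 + p.2) ∪ A (p.1 - p.2)) := by
    rintro ω ⟨x, y, hxy⟩
    by_contra hω
    simp only [Set.mem_iUnion, not_exists, Set.mem_union, not_or, A, Set.mem_ofPred_eq, not_lt,
      mem_product] at hω
    refine absurd hxy (not_lt.2 (abs_bilin_le_of_net hN _ (fun u hu v hv => ?_) x y))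
    obtain ⟨h1, h2⟩ := hω (u, v) ⟨hu, hv⟩
    set B := noiseForm (bucketLength n ℓ) (fun i : Fin ℓ => bucketMean ℓ (fun j => ξ j ω) i)
    have hsymm : B v u = B u v := by
      simp only [B, noiseForm_apply, mul_comm, real_inner_comm]
    have hpol : B u v = (B (u + v) (u + v) - B (u - v) (u - v)) / 4 := by
      simp only [map_add, map_sub, LinearMap.add_apply, LinearMap.sub_apply, hsymm]
      ring
    have hpar := parallelogram_law_with_norm ℝ u v
    have hu1 := hN1 u hu
    have hv1 := hN1 v hv
    have h3 := abs_le.1 h1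
    have h4 := abs_le.1 h2
    have h5 : s * ‖u + v‖ ^ 2 + s * ‖u - v‖ ^ 2 ≤ 4 * s := by
      rw [← mul_add, show ‖u + v‖ ^ 2 + ‖u - v‖ ^ 2 = 2 * (‖u‖ ^ 2 + ‖v‖ ^ 2) by
        linarith]
      have : ‖u‖ ^ 2 ≤ 1 := pow_le_one₀ (norm_nonneg _) hu1
      have : ‖v‖ ^ 2 ≤ 1 := pow_le_one₀ (norm_nonneg _) hv1
      nlinarith
    rw [hpol, abs_le]
    constructor <;> linarith
  refine (measureReal_mono hsub (measure_ne_top _ _)).trans ((measureReal_biUnion_finset_le _ _).trans ?_)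
  refine (sum_le_card_nsmul _ _ (4 * Real.exp (-5 * d)) fun p _ => ?_).trans ?_
  · refine (measureReal_union_le _ _).trans ?_
    linarith [hA (p.1 + p.2), hA (p.1 - p.2)]
  · rw [card_product, nsmul_eq_mul]
    have h25 : ((#N * #N : ℕ) : ℝ) ≤ Real.exp (4 * d) := by
      calc ((#N * #N : ℕ) : ℝ) ≤ ((5 ^ d * 5 ^ d : ℕ) : ℝ) := by
            exact_mod_cast Nat.mul_le_mul hNc hNc
        _ = (25 : ℝ) ^ d := by push_cast; rw [← mul_pow]; norm_num
        _ ≤ Real.exp 4 ^ d := by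
            refine pow_le_pow_left₀ (by norm_num) ?_ d
            have : Real.exp 4 = Real.exp 1 ^ 4 := by rw [← Real.exp_nat_mul]; norm_num
            rw [this]
            have := Real.exp_one_gt_d9
            calc (25 : ℝ) ≤ 2.7 ^ 4 := by norm_num
              _ ≤ _ := pow_le_pow_left₀ (by norm_num) (by linarith) 4
        _ = _ := by rw [← Real.exp_nat_mul, mul_comm]
    calc ((#N * #N : ℕ) : ℝ) * (4 * Real.exp (-5 * d))
        ≤ Real.exp (4 * d) * (4 * Real.exp (-5 * d)) :=
          mul_le_mul_of_nonneg_right h25 (by positivity)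
      _ = 4 * Real.exp (-(d : ℝ)) := by
          rw [mul_left_comm, ← Real.exp_add]; ring_nf

/-- The coefficients are frozen label means. For fixed u in the net the sum has variance proxy at
most ℓ/k, so the tail is e^(-9d/2), which beats the net size 5^d ≤ e^(7d/2). -/
theorem measureReal_norm_sum_smul_bucketMean_gt_le [IsProbabilityMeasure μ]
    (hd : 1 ≤ d) (hm : ∀ j, Measurable (ξ j))
    (hind : iIndepFun ξ μ) (hξ : ∀ j, IsIsotropicSubGaussian (ξ j) μ) {ℓ : ℕ} (hl : 1 ≤ ℓ)
    (hln : ℓ ≤ n) {a : Fin ℓ → ℝ} (ha : ∀ i, a i ^ 2 ≤ 1) :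
    μ.real {ω | 2 * (3 * Real.sqrt (d * ℓ / bucketLength n ℓ)) <
      ‖∑ i, a i • bucketMean ℓ (fun j => ξ j ω) i‖} ≤ 2 * Real.exp (-(d : ℝ)) := by
  obtain ⟨N, hNc, hN1, hN⟩ := exists_half_net d
  have hk : (0 : ℝ) < bucketLength n ℓ := by exact_mod_cast bucketLength_pos hl hln
  have hl0 : (0 : ℝ) < ℓ := by exact_mod_cast hl
  set s := 3 * Real.sqrt (d * ℓ / bucketLength n ℓ) with hs
  have htail : ∀ (b : Fin ℓ → ℝ), (∀ i, b i ^ 2 ≤ 1) → ∀ u ∈ N,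
      μ.real {ω | s ≤ ∑ i, b i * inner ℝ u (bucketMean ℓ (fun j => ξ j ω) i)} ≤
        Real.exp (-(9 / 2) * d) := by
    intro b hb u hu
    have h := HasSubgaussianMGF.measure_sum_ge_le_of_iIndepFun (μ := μ) (s := univ)
      (X := fun i ω => b i * inner ℝ u (bucketMean ℓ (fun j => ξ j ω) i))
      (c := fun _ => 1 / (bucketLength n ℓ : NNReal))
      ((iIndepFun_inner_bucketMean hm hind ℓ u).comp (fun i x => b i * x) fun _ => by fun_prop)
      (fun i _ => hasSubgaussianMGF_const_mul
        (hasSubgaussianMGF_inner_bucketMean hind hξ hl hln u i) (b i) (by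
          push_cast
          rw [mul_div_assoc']
          refine div_le_div_of_nonneg_right ?_ hk.le
          exact mul_le_one₀ (hb i) (sq_nonneg _) (pow_le_one₀ (norm_nonneg _) (hN1 u hu))))
      (ε := s) (by positivity)
    refine h.trans (Real.exp_le_exp.2 (le_of_eq ?_))
    rw [hs, mul_pow, Real.sq_sqrt (by positivity)]
    simp only [sum_const, card_univ, Fintype.card_fin, nsmul_eq_mul]
    push_cast
    field_simp
    norm_num
  let A : EuclideanSpace ℝ (Fin d) → Set Ω := fun u =>
    {ω | s ≤ |∑ i, a i * inner ℝ u (bucketMean ℓ (fun j => ξ j ω) i)|}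
  have hA : ∀ u ∈ N, μ.real (A u) ≤ 2 * Real.exp (-(9 / 2) * d) := by
    intro u hu
    have h1 := htail a ha u hu
    have h2 := htail (fun i => -a i) (fun i => by rw [neg_sq]; exact ha i) u hu
    refine (measureReal_mono
      (s₂ := {ω | s ≤ ∑ i, a i * inner ℝ u (bucketMean ℓ (fun j => ξ j ω) i)} ∪
        {ω | s ≤ ∑ i, -a i * inner ℝ u (bucketMean ℓ (fun j => ξ j ω) i)}) (fun ω hω => ?_)
      (measure_ne_top _ _)).trans ((measureReal_union_le _ _).trans (by linarith))
    simp only [A, Set.mem_union, Set.mem_ofPred_eq, neg_mul, sum_neg_distrib] at hω ⊢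
    exact le_abs.1 hω
  have hsub : {ω | 2 * s < ‖∑ i, a i • bucketMean ℓ (fun j => ξ j ω) i‖} ⊆ ⋃ u ∈ N, A u := by
    intro ω hω
    by_contra hc
    simp only [Set.mem_iUnion, not_exists, A, Set.mem_ofPred_eq, not_le] at hc
    refine absurd hω (not_lt.2 (norm_le_of_net hN _ fun u hu => ?_))
    simp only [inner_sum, real_inner_smul_right]
    exact (hc u hu).le
  refine (measureReal_mono hsub (measure_ne_top _ _)).trans ((measureReal_biUnion_finset_le _ _).trans ?_)
  refine (sum_le_card_nsmul _ _ _ hA).trans ?_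
  rw [nsmul_eq_mul]
  have h5 : (#N : ℝ) ≤ Real.exp (7 / 2 * d) := by
    calc (#N : ℝ) ≤ ((5 ^ d : ℕ) : ℝ) := by exact_mod_cast hNc
      _ = (5 : ℝ) ^ d := by push_cast; rfl
      _ ≤ Real.exp (7 / 2) ^ d := by
          refine pow_le_pow_left₀ (by norm_num) ?_ d
          have := Real.quadratic_le_exp_of_nonneg (x := 7 / 2) (by norm_num)
          linarith
      _ = _ := by rw [← Real.exp_nat_mul, mul_comm]
  calc (#N : ℝ) * (2 * Real.exp (-(9 / 2) * d))
      ≤ Real.exp (7 / 2 * d) * (2 * Real.exp (-(9 / 2) * d)) :=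
        mul_le_mul_of_nonneg_right h5 (by positivity)
    _ = 2 * Real.exp (-(d : ℝ)) := by rw [mul_left_comm, ← Real.exp_add]; ring_nf

theorem measurableSet_norm_sum_smul_bucketMean_gt {ℓ : ℕ} (c : ℝ) (a : Fin ℓ → ℝ) :
    MeasurableSet {x : Fin n → EuclideanSpace ℝ (Fin d) | c < ‖∑ i, a i • bucketMean ℓ x i‖} := by
  refine measurableSet_lt measurable_const (Measurable.norm ?_)
  refine Finset.measurable_fun_sum _ fun i _ => ?_
  exact (measurable_bucketMean (ξ := fun j (x : Fin n → EuclideanSpace ℝ (Fin d)) => x j)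
    (fun j => measurable_pi_apply j) ℓ i).const_smul (a i)

/-- Conditioning on the labels: they are finitely valued and independent of the noise, and the
frozen bound is uniform in the path. -/
theorem measureReal_norm_sum_labelMean_smul_gt_le [IsProbabilityMeasure μ] {η : Fin n → Ω → ℤˣ}
    (hd : 1 ≤ d) (hη : ∀ i, Measurable (η i)) (hm : ∀ j, Measurable (ξ j))
    (hind : iIndepFun ξ μ) (hξ : ∀ j, IsIsotropicSubGaussian (ξ j) μ)
    (hindη : IndepFun (fun ω i => ξ i ω) (fun ω i => η i ω) μ) {ℓ : ℕ} (hl : 1 ≤ ℓ)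
    (hln : ℓ ≤ n) :
    μ.real {ω | 2 * (3 * Real.sqrt (d * ℓ / bucketLength n ℓ)) <
      ‖∑ i, labelMean ℓ (fun j => η j ω) i • bucketMean ℓ (fun j => ξ j ω) i‖} ≤
      2 * Real.exp (-(d : ℝ)) :=
  measureReal_mem_le_of_indepFun hindη (measurable_pi_lambda _ hη)
    (U := fun s => {x | 2 * (3 * Real.sqrt (d * ℓ / bucketLength n ℓ)) <
      ‖∑ i, labelMean ℓ s i • bucketMean ℓ x i‖})
    (fun s => measurableSet_norm_sum_smul_bucketMean_gt _ (labelMean ℓ s))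
    fun s => measureReal_norm_sum_smul_bucketMean_gt_le hd hm hind hξ hl hln
      fun i => labelMean_sq_le_one hl hln s i

end Noise

/-! ### Spectral perturbation -/

/-- In a nontrivial finite-dimensional space the supremum of the Rayleigh quotient is an eigenvalue,
hence at most `lambdaMax A`. -/
theorem inner_toEuclideanLin_le_lambdaMax {d : ℕ} (hd : 1 ≤ d) {A : Matrix (Fin d) (Fin d) ℝ}
    (hA : A.IsSymm) (x : EuclideanSpace ℝ (Fin d)) :
    inner ℝ x (Matrix.toEuclideanLin A x) ≤ lambdaMax A * ‖x‖ ^ 2 := by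
  have : NeZero d := ⟨by omega⟩
  have hH : A.IsHermitian := by
    rw [Matrix.IsHermitian, Matrix.conjTranspose_eq_transpose_of_trivial]; exact hA
  have hS := Matrix.isSymmetric_toEuclideanLin_iff.2 hH
  set T := Matrix.toEuclideanLin A
  rcases eq_or_ne x 0 with rfl | hx
  · simp
  have hx0 : 0 < ‖x‖ ^ 2 := by positivity
  have hev := hS.hasEigenvalue_iSup_of_finiteDimensional
  have hsup : (⨆ x : {x : EuclideanSpace ℝ (Fin d) // x ≠ 0},
      RCLike.re (inner ℝ (T x) x) / ‖(x : EuclideanSpace ℝ (Fin d))‖ ^ 2 : ℝ) ≤ lambdaMax A :=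
    le_csSup (Module.End.finite_hasEigenvalue T).bddAbove hev
  have hbdd : BddAbove (Set.range fun x : {x : EuclideanSpace ℝ (Fin d) // x ≠ 0} =>
      RCLike.re (inner ℝ (T x) x) / ‖(x : EuclideanSpace ℝ (Fin d))‖ ^ 2) := by
    refine ⟨‖LinearMap.toContinuousLinearMap T‖, ?_⟩
    rintro _ ⟨⟨z, hz⟩, rfl⟩
    have hz0 : 0 < ‖z‖ ^ 2 := by positivity
    simp only [RCLike.re_to_real]
    rw [div_le_iff₀ hz0]
    refine (real_inner_le_norm _ _).trans ?_
    have := (LinearMap.toContinuousLinearMap T).le_opNorm z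
    calc ‖T z‖ * ‖z‖ ≤ ‖LinearMap.toContinuousLinearMap T‖ * ‖z‖ * ‖z‖ :=
          mul_le_mul_of_nonneg_right this (norm_nonneg _)
      _ = _ := by ring
  have h := (le_ciSup hbdd ⟨x, hx⟩).trans hsup
  simp only [RCLike.re_to_real] at h
  rw [div_le_iff₀ hx0, real_inner_comm] at h
  exact h

/-- The top eigenpair of a perturbation of `α θ θᵀ + κ I`. -/
theorem top_eigenpair_of_perturbation {d : ℕ} (hd : 1 ≤ d) {A : Matrix (Fin d) (Fin d) ℝ}
    (hA : A.IsSymm) {v θ : EuclideanSpace ℝ (Fin d)} (hv : ‖v‖ = 1)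
    (hev : Module.End.HasEigenvector (Matrix.toEuclideanLin A) (lambdaMax A) v) {α κ e : ℝ}
    (hα : 0 ≤ α)
    (hform : ∀ x z : EuclideanSpace ℝ (Fin d), |inner ℝ x (Matrix.toEuclideanLin A z) -
      α * (inner ℝ x θ * inner ℝ z θ) - κ * inner ℝ x z| ≤ e * ‖x‖ * ‖z‖) :
    |lambdaMax A - κ - α * ‖θ‖ ^ 2| ≤ e ∧
      α * (‖θ‖ ^ 2 - inner ℝ v θ ^ 2) ≤ 2 * e ∧
      α ^ 2 * inner ℝ v θ ^ 2 * (‖θ‖ ^ 2 - inner ℝ v θ ^ 2) ≤ e ^ 2 := by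
  set T := Matrix.toEuclideanLin A
  set l := lambdaMax A with hl
  set g := inner ℝ v θ with hg
  have hTv : T v = l • v := hev.apply_eq_smul
  have hvv : inner ℝ v v = (1 : ℝ) := by rw [real_inner_self_eq_norm_sq, hv, one_pow]
  have hgT : g ^ 2 ≤ ‖θ‖ ^ 2 := by
    have := abs_real_inner_le_norm v θ
    rw [hv, one_mul] at this
    rw [← sq_abs]
    exact pow_le_pow_left₀ (abs_nonneg _) this 2
  have h1 := hform v v
  rw [hTv, real_inner_smul_right, hvv, hv, ← hg] at h1
  have h1' := abs_le.1 h1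
  have he : 0 ≤ e := by linarith [h1'.1, h1'.2]
  -- The lower bound tests the form on θ, the upper bound `hup` on v; comparing the two bounds the
  -- angle at first order in e.
  have hlow : α * ‖θ‖ ^ 2 + κ - e ≤ l := by
    rcases eq_or_ne θ 0 with h0 | h0
    · have : g = 0 := by rw [hg, h0, inner_zero_right]
      rw [this] at h1'
      rw [h0, norm_zero]
      linarith [h1'.1]
    · have hθ : 0 < ‖θ‖ ^ 2 := by positivity
      have h2 := inner_toEuclideanLin_le_lambdaMax hd hA θ
      have h3 := (abs_le.1 (hform θ θ)).1
      rw [real_inner_self_eq_norm_sq] at h3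
      have h4 : (α * ‖θ‖ ^ 2 + κ - e) * ‖θ‖ ^ 2 ≤ l * ‖θ‖ ^ 2 := by nlinarith
      exact le_of_mul_le_mul_right h4 hθ
  have hup : l ≤ α * g ^ 2 + κ + e := by nlinarith [h1'.2]
  refine ⟨abs_le.2 ⟨by linarith, ?_⟩, by nlinarith, ?_⟩
  · have := mul_le_mul_of_nonneg_left hgT hα
    linarith
  -- The component of θ orthogonal to v is tested against v: the eigenvalue and κ terms vanish. This
  -- gives the second-order angle bound, without which the loss would be of order e instead of e²/T.
  · have hw2 : ‖θ - g • v‖ ^ 2 = ‖θ‖ ^ 2 - g ^ 2 := by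
      rw [norm_sub_sq_real, real_inner_smul_right, real_inner_comm, ← hg, norm_smul, hv, mul_one,
        Real.norm_eq_abs, sq_abs]
      ring
    have hwv : inner ℝ (θ - g • v) v = (0 : ℝ) := by
      rw [inner_sub_left, real_inner_smul_left, hvv, real_inner_comm, ← hg]; ring
    have hwθ : inner ℝ (θ - g • v) θ = ‖θ‖ ^ 2 - g ^ 2 := by
      rw [inner_sub_left, real_inner_smul_left, real_inner_self_eq_norm_sq, ← hg]; ring
    have h5 := hform (θ - g • v) v
    rw [hTv, real_inner_smul_right, hwv, hwθ, hv, ← hg, ← hw2] at h5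
    set w := ‖θ - g • v‖
    have hw0 : 0 ≤ w := norm_nonneg _
    rw [← hw2]
    have h6 : α * w ^ 2 * |g| ≤ e * w := by
      have : |l * 0 - α * (w ^ 2 * g) - κ * 0| = α * w ^ 2 * |g| := by
        rw [show l * 0 - α * (w ^ 2 * g) - κ * 0 = -(α * w ^ 2 * g) by ring, abs_neg, abs_mul,
          abs_of_nonneg (by positivity)]
      linarith
    rcases hw0.eq_or_lt with h | h
    · rw [← h]; simp [sq_nonneg]
    · have h7 : α * w * |g| ≤ e := by
        refine le_of_mul_le_mul_right ?_ h
        linarith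
      calc α ^ 2 * g ^ 2 * w ^ 2 = (α * w * |g|) ^ 2 := by rw [mul_pow, mul_pow, sq_abs]; ring
        _ ≤ e ^ 2 := pow_le_pow_left₀ (by positivity) h7 2

/-! ### The loss of a rescaled unit vector -/

/-- Pythagoras: the first term is the error along v after choosing the sign, the second is the part
of θ orthogonal to v. -/
theorem signLoss_sq_le {d : ℕ} {v θ : EuclideanSpace ℝ (Fin d)} (hv : ‖v‖ = 1) (s : ℝ) :
    signLoss (s • v) θ ^ 2 ≤ (s - |inner ℝ v θ|) ^ 2 + (‖θ‖ ^ 2 - inner ℝ v θ ^ 2) := by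
  have h0 : 0 ≤ signLoss (s • v) θ := le_min (norm_nonneg _) (norm_nonneg _)
  rcases le_total 0 (inner ℝ v θ) with h | h
  · refine (pow_le_pow_left₀ h0 (min_le_left _ _) 2).trans (le_of_eq ?_)
    rw [norm_sub_sq_real, real_inner_smul_left, norm_smul, hv, abs_of_nonneg h, Real.norm_eq_abs,
      mul_one, sq_abs]
    ring
  · refine (pow_le_pow_left₀ h0 (min_le_right _ _) 2).trans (le_of_eq ?_)
    rw [norm_add_sq_real, real_inner_smul_left, norm_smul, hv, abs_of_nonpos h, Real.norm_eq_abs,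
      mul_one, sq_abs]
    ring

theorem signLoss_sq_le_two_mul {d : ℕ} (t θ : EuclideanSpace ℝ (Fin d)) :
    signLoss t θ ^ 2 ≤ 2 * (‖t‖ ^ 2 + ‖θ‖ ^ 2) := by
  have h0 : 0 ≤ signLoss t θ := le_min (norm_nonneg _) (norm_nonneg _)
  have h1 : signLoss t θ ≤ ‖t‖ + ‖θ‖ := (min_le_left _ _).trans (norm_sub_le _ _)
  nlinarith [sq_nonneg (‖t‖ - ‖θ‖)]

theorem sq_sqrt_sub_sqrt_le {S T : ℝ} (hS : 0 ≤ S) (hT : 0 < T) :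
    (Real.sqrt S - Real.sqrt T) ^ 2 ≤ (S - T) ^ 2 / T := by
  have hs := Real.sqrt_nonneg S
  have ht := Real.sqrt_nonneg T
  have h : S - T = (Real.sqrt S - Real.sqrt T) * (Real.sqrt S + Real.sqrt T) := by
    nlinarith [Real.sq_sqrt hS, Real.sq_sqrt hT.le]
  rw [le_div_iff₀ hT, h, mul_pow]
  refine mul_le_mul_of_nonneg_left ?_ (sq_nonneg _)
  nlinarith [Real.sq_sqrt hS, Real.sq_sqrt hT.le, mul_nonneg hs ht]

/-! ### The spectral estimator -/

theorem isSymm_sampleCov {d n : ℕ} (ℓ : ℕ) (y : Fin n → EuclideanSpace ℝ (Fin d)) :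
    (sampleCov ℓ y).IsSymm := by
  ext a b
  simp only [Matrix.transpose_apply, sampleCov, mul_comm]

theorem inner_toEuclideanLin_sampleCov {d n : ℕ} (ℓ : ℕ) (y : Fin n → EuclideanSpace ℝ (Fin d))
    (x z : EuclideanSpace ℝ (Fin d)) :
    inner ℝ x (Matrix.toEuclideanLin (sampleCov ℓ y) z) =
      1 / (ℓ : ℝ) * ∑ i, inner ℝ x (bucketMean ℓ y i) * inner ℝ z (bucketMean ℓ y i) := by
  have h : ∀ u w : EuclideanSpace ℝ (Fin d), inner ℝ u w = ∑ a, u a * w a := fun u w => by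
    simp [PiLp.inner_apply, mul_comm]
  simp only [h, Matrix.toLpLin_apply, Matrix.mulVec, dotProduct, sampleCov]
  simp only [mul_sum, sum_mul]
  rw [sum_comm' (t' := univ) (s' := fun _ => univ) (by simp)]
  conv_lhs => enter [2, b]; rw [sum_comm]
  rw [sum_comm]
  refine sum_congr rfl fun i _ => ?_
  refine sum_congr rfl fun a _ => sum_congr rfl fun b _ => ?_
  ring

/-- The squared norm of the spectral estimator. -/
noncomputable def signalEstimate {d n : ℕ} (δ : ℝ) (y : Fin n → EuclideanSpace ℝ (Fin d)) (ℓ : ℕ) :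
    ℝ :=
  (ℓ : ℝ) / labelEnergy n δ ℓ *
    max (lambdaMax (sampleCov ℓ y) - 1 / (bucketLength n ℓ : ℝ)) 0

/-- The deterministic event on which `θ̂(ℓ)` performs well: the sample covariance is close to
`α θ θᵀ + k⁻¹ I`, and the label energy `α` is close to its mean and bounded below. -/
def IsSpectralGood {d n : ℕ} (δ : ℝ) (θ : EuclideanSpace ℝ (Fin d))
    (y : Fin n → EuclideanSpace ℝ (Fin d)) (ℓ : ℕ) (α : ℝ) : Prop :=
  (∀ x z : EuclideanSpace ℝ (Fin d),
    |inner ℝ x (Matrix.toEuclideanLin (sampleCov ℓ y) z) - α * (inner ℝ x θ * inner ℝ z θ) -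
      1 / (bucketLength n ℓ : ℝ) * inner ℝ x z| ≤
      1152 * (‖θ‖ * Real.sqrt (d / n) + Real.sqrt (d / n * (ℓ / n))) * ‖x‖ * ‖z‖) ∧
  (1 / 16 ≤ α ∧ α ≤ 1) ∧ ((ℓ : ℝ) / 8 ≤ labelEnergy n δ ℓ ∧ labelEnergy n δ ℓ ≤ ℓ) ∧
  |α - labelEnergy n δ ℓ / ℓ| ≤ 2 * (Real.sqrt (δ * (d / n)) + d / n) / (ℓ / n) ∧
  (ℓ = n → α = labelEnergy n δ ℓ / ℓ)

section Estimator

variable {d n ℓ : ℕ} {δ α : ℝ} {θ : EuclideanSpace ℝ (Fin d)}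
  {y : Fin n → EuclideanSpace ℝ (Fin d)}
  {vmax : Matrix (Fin d) (Fin d) ℝ → EuclideanSpace ℝ (Fin d)}

theorem signalEstimate_nonneg (hE : 0 ≤ labelEnergy n δ ℓ) : 0 ≤ signalEstimate δ y ℓ :=
  mul_nonneg (div_nonneg (Nat.cast_nonneg _) hE) (le_max_right _ _)

theorem thetaHat_eq :
    thetaHat vmax δ y ℓ = Real.sqrt (signalEstimate δ y ℓ) • vmax (sampleCov ℓ y) := by
  rw [thetaHat, signalEstimate]

theorem norm_thetaHat_sq (hvmax : IsTopEigenvectorChoice vmax) (hE : 0 ≤ labelEnergy n δ ℓ) :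
    ‖thetaHat vmax δ y ℓ‖ ^ 2 = signalEstimate δ y ℓ := by
  rw [thetaHat_eq, norm_smul, (hvmax _ (isSymm_sampleCov ℓ y)).1, mul_one, Real.norm_eq_abs, sq_abs,
    Real.sq_sqrt (signalEstimate_nonneg hE)]

/-- The first two bounds are crude and serve the pilot estimate and weak signals; the third is for
strong signals. The 8 and 1/16 come from the lower bounds on the mean label energy and on α. -/
theorem IsSpectralGood.abs_signalEstimate_sub_le (h : IsSpectralGood δ θ y ℓ α) (hd : 1 ≤ d)
    (hl : 1 ≤ ℓ) (hvmax : IsTopEigenvectorChoice vmax) {e : ℝ}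
    (he : e = 1152 * (‖θ‖ * Real.sqrt (d / n) + Real.sqrt (d / n * (ℓ / n)))) :
    signalEstimate δ y ℓ ≤ 8 * (‖θ‖ ^ 2 + e) ∧ ‖θ‖ ^ 2 / 16 - e ≤ signalEstimate δ y ℓ ∧
      |signalEstimate δ y ℓ - ‖θ‖ ^ 2| ≤
        8 * (e + |α - labelEnergy n δ ℓ / ℓ| * ‖θ‖ ^ 2) := by
  have hl0 : (0 : ℝ) < ℓ := by exact_mod_cast hl
  obtain ⟨hform, ⟨hα, hα1⟩, ⟨hmean, hmean'⟩, -, -⟩ := h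
  obtain ⟨hv1, hv2⟩ := hvmax _ (isSymm_sampleCov ℓ y)
  obtain ⟨h1, -, -⟩ := top_eigenpair_of_perturbation hd (isSymm_sampleCov ℓ y) hv1 hv2
    (by linarith) (he ▸ hform)
  set X := lambdaMax (sampleCov ℓ y) - 1 / (bucketLength n ℓ : ℝ) with hX
  set m := labelEnergy n δ ℓ / ℓ with hm
  have hm8 : 1 / 8 ≤ m := by rw [hm, le_div_iff₀ hl0]; linarith
  have hm1 : m ≤ 1 := by rw [hm, div_le_one hl0]; exact hmean'
  have hm0 : 0 < m := by linarith
  have hS : signalEstimate δ y ℓ = max X 0 / m := by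
    rw [signalEstimate, hm, ← hX, div_div_eq_mul_div, div_mul_eq_mul_div, mul_comm]
  have hT : 0 ≤ ‖θ‖ ^ 2 := sq_nonneg _
  have h1' := abs_le.1 h1
  have he0 : 0 ≤ e := (abs_nonneg _).trans h1
  have hX0 : 0 ≤ max X 0 := le_max_right _ _
  rw [hS]
  refine ⟨?_, ?_, ?_⟩
  · rw [div_le_iff₀ hm0]
    have h2 : max X 0 ≤ ‖θ‖ ^ 2 + e := max_le (by nlinarith) (by linarith)
    nlinarith
  · rw [le_div_iff₀ hm0]
    have h2 : ‖θ‖ ^ 2 / 16 - e ≤ max X 0 := le_max_of_le_left (by nlinarith)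
    rcases le_total 0 (‖θ‖ ^ 2 / 16 - e) with h3 | h3 <;> nlinarith
  · have h2 : |max X 0 - m * ‖θ‖ ^ 2| ≤ e + |α - m| * ‖θ‖ ^ 2 := by
      have h3 : |max X 0 - max (m * ‖θ‖ ^ 2) 0| ≤ |X - m * ‖θ‖ ^ 2| :=
        abs_max_sub_max_le_abs _ _ _
      rw [max_eq_left (by positivity : 0 ≤ m * ‖θ‖ ^ 2)] at h3
      refine h3.trans ?_
      have h4 : X - m * ‖θ‖ ^ 2 = (X - α * ‖θ‖ ^ 2) + (α - m) * ‖θ‖ ^ 2 := by ring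
      rw [h4]
      refine (abs_add_le _ _).trans (add_le_add h1 ?_)
      rw [abs_mul, abs_of_nonneg hT]
    have h5 : max X 0 / m - ‖θ‖ ^ 2 = (max X 0 - m * ‖θ‖ ^ 2) / m := by field_simp
    rw [h5, abs_div, abs_of_pos hm0, div_le_iff₀ hm0]
    have : 0 ≤ e + |α - m| * ‖θ‖ ^ 2 := (abs_nonneg _).trans h2
    nlinarith

theorem IsSpectralGood.signLoss_sq_le (h : IsSpectralGood δ θ y ℓ α) (hd : 1 ≤ d)
    (hl : 1 ≤ ℓ) (hvmax : IsTopEigenvectorChoice vmax) {e : ℝ}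
    (he : e = 1152 * (‖θ‖ * Real.sqrt (d / n) + Real.sqrt (d / n * (ℓ / n))))
    (hT : 0 < ‖θ‖ ^ 2) (heT : 64 * e ≤ ‖θ‖ ^ 2) :
    signLoss (thetaHat vmax δ y ℓ) θ ^ 2 ≤
      2000 * (e ^ 2 / ‖θ‖ ^ 2 + (α - labelEnergy n δ ℓ / ℓ) ^ 2 * ‖θ‖ ^ 2) := by
  obtain ⟨-, -, h4⟩ := h.abs_signalEstimate_sub_le hd hl hvmax he
  obtain ⟨hform, ⟨hα, -⟩, ⟨hmean, -⟩, -, -⟩ := h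
  obtain ⟨hv1, hv2⟩ := hvmax _ (isSymm_sampleCov ℓ y)
  have hE : 0 ≤ labelEnergy n δ ℓ := le_trans (by positivity) hmean
  obtain ⟨-, h2, h3⟩ := top_eigenpair_of_perturbation hd (isSymm_sampleCov ℓ y) hv1 hv2
    (by linarith) (he ▸ hform)
  set v := vmax (sampleCov ℓ y)
  set g := inner ℝ v θ with hg
  set T := ‖θ‖ ^ 2 with hTdef
  set S := signalEstimate δ y ℓ with hSdef
  set b := |α - labelEnergy n δ ℓ / ℓ| with hb
  have hb2 : (α - labelEnergy n δ ℓ / ℓ) ^ 2 = b ^ 2 := (sq_abs _).symm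
  have hS0 : 0 ≤ S := signalEstimate_nonneg hE
  have hloss : signLoss (thetaHat vmax δ y ℓ) θ ^ 2 ≤ (Real.sqrt S - |g|) ^ 2 + (T - g ^ 2) := by
    rw [thetaHat_eq]
    exact _root_.signLoss_sq_le hv1 (Real.sqrt S)
  have hgT : g ^ 2 ≤ T := by
    have := abs_real_inner_le_norm v θ
    rw [hv1, one_mul] at this
    rw [← sq_abs]
    exact pow_le_pow_left₀ (abs_nonneg _) this 2
  -- The first-order angle bound and 64e ≤ T give g² ≥ T/2; inserting this in the second-order bound
  -- with α ≥ 1/16 gives 512.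
  have hw : T - g ^ 2 ≤ 512 * e ^ 2 / T := by
    have h5 : T / 2 ≤ g ^ 2 := by nlinarith
    rw [le_div_iff₀ hT]
    have h6 : 1 / 256 ≤ α ^ 2 := by nlinarith
    have h7 : 1 / 512 * T ≤ α ^ 2 * g ^ 2 := by nlinarith
    have := mul_le_mul_of_nonneg_right h7 (sub_nonneg.2 hgT)
    linarith
  have hsqrt : (Real.sqrt T - |g|) ^ 2 ≤ T - g ^ 2 := by
    have h8 : |g| ≤ Real.sqrt T := Real.abs_le_sqrt hgT
    have h9 := Real.sq_sqrt hT.le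
    nlinarith [abs_nonneg g, sq_abs g]
  have hST : (Real.sqrt S - Real.sqrt T) ^ 2 ≤ 128 * (e ^ 2 / T + b ^ 2 * T) := by
    refine (sq_sqrt_sub_sqrt_le hS0 hT).trans ?_
    rw [div_le_iff₀ hT]
    have h10 : (S - T) ^ 2 ≤ (8 * (e + b * T)) ^ 2 := sq_le_sq.2 (h4.trans (le_abs_self _))
    refine h10.trans ?_
    have : 128 * (e ^ 2 / T + b ^ 2 * T) * T = 128 * (e ^ 2 + (b * T) ^ 2) := by field_simp
    rw [this]
    nlinarith [sq_nonneg (e - b * T)]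
  have hsplit : (Real.sqrt S - |g|) ^ 2 ≤
      2 * (Real.sqrt S - Real.sqrt T) ^ 2 + 2 * (Real.sqrt T - |g|) ^ 2 := by
    nlinarith [sq_nonneg ((Real.sqrt S - Real.sqrt T) - (Real.sqrt T - |g|))]
  rw [hb2]
  have h11 : 0 ≤ e ^ 2 / T := by positivity
  have h12 : 0 ≤ b ^ 2 * T := by positivity
  have h13 : 512 * e ^ 2 / T = 512 * (e ^ 2 / T) := by ring
  linarith

end Estimator

/-! ### The dyadic grid -/

/-- By minimality of the exponent its predecessor is too small, hence the factor 2. The last clause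
limits the possible values to M + 1, as the union bound requires. -/
theorem dyadicRoundUp_spec {d n u : ℕ} (hd : 1 ≤ d) (hdn : d ≤ n) (hdu : d ≤ u) (hun : u ≤ n) :
    u ≤ dyadicRoundUp d n u ∧ dyadicRoundUp d n u ≤ 2 * u ∧
      ∀ M, n ≤ d * 2 ^ M → ∃ m ≤ M, dyadicRoundUp d n u = min (d * 2 ^ m) n := by
  have hmem : ∀ M, n ≤ d * 2 ^ M → M ∈ {m : ℕ | u ≤ min (d * 2 ^ m) n} := fun M hM =>
    le_min (hun.trans hM) hun
  have hne : {m : ℕ | u ≤ min (d * 2 ^ m) n}.Nonempty :=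
    ⟨n, hmem n (Nat.lt_two_pow_self.le.trans (Nat.le_mul_of_pos_left _ hd))⟩
  refine ⟨Nat.sInf_mem hne, ?_, fun M hM => ⟨_, Nat.sInf_le (hmem M hM), rfl⟩⟩
  unfold dyadicRoundUp
  rcases Nat.eq_zero_or_pos (sInf {m : ℕ | u ≤ min (d * 2 ^ m) n}) with h | h
  · rw [h, pow_zero, mul_one]
    omega
  · obtain ⟨m, hm⟩ := Nat.exists_eq_add_of_lt h
    rw [zero_add] at hm
    have hlt : m ∉ {m : ℕ | u ≤ min (d * 2 ^ m) n} := Nat.notMem_of_lt_sInf (by omega)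
    simp only [Set.mem_ofPred_eq, le_min_iff, not_and_or, not_le] at hlt
    have h2 : d * 2 ^ m < u := hlt.resolve_right (by omega)
    rw [hm, pow_succ, ← mul_assoc]
    omega

/-! ### The rates -/

section Rates

variable {d n : ℕ} {δ : ℝ} {θ : EuclideanSpace ℝ (Fin d)}

/-- With q = max(δ, D), the weak-signal threshold max(√(δD), D) becomes the single expression √(Dq).
-/
theorem sqrt_mul_max_eq {D δ : ℝ} (hD : 0 ≤ D) :
    Real.sqrt (D * max δ D) = max (Real.sqrt (δ * D)) D := by
  rw [mul_max_of_nonneg _ _ hD, Real.sqrt_monotone.map_max, Real.sqrt_mul_self hD, mul_comm]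

theorem localRate_eq (n : ℕ) (δ : ℝ) (θ : EuclideanSpace ℝ (Fin d)) : localRate n δ θ =
    if ‖θ‖ ^ 2 ≤ Real.sqrt ((d : ℝ) / n * max δ ((d : ℝ) / n)) then
      Real.sqrt (δ * (d / n)) + (d : ℝ) / n
    else if ‖θ‖ ^ 2 ≤ max δ ((d : ℝ) / n) then (δ * (d / n)) / ‖θ‖ ^ 2
    else (d : ℝ) / n := by
  rw [localRate, sqrt_mul_max_eq (by positivity), mul_div_assoc]

theorem max_eq_left_of_sqrt_lt {D δ T : ℝ} (hD : 0 ≤ D) (h1 : Real.sqrt (D * max δ D) < T)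
    (h2 : T ≤ max δ D) : max δ D = δ := by
  rcases le_total D δ with h | h
  · exact max_eq_left h
  · rw [max_eq_right h] at h1 h2
    rw [Real.sqrt_mul_self hD] at h1
    linarith

theorem localRate_le_globalRate (hδ : 0 ≤ δ) : localRate n δ θ ≤ globalRate d n δ := by
  rw [localRate_eq, globalRate, mul_div_assoc δ (d : ℝ) (n : ℝ)]
  set D : ℝ := (d : ℝ) / n
  have hD : 0 ≤ D := by positivity
  have hs := Real.sqrt_nonneg (δ * D)
  split_ifs with h1 h2
  · exact le_rfl
  · rw [not_le] at h1
    have hq := max_eq_left_of_sqrt_lt hD h1 h2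
    rw [hq, mul_comm] at h1
    have hT : 0 < ‖θ‖ ^ 2 := hs.trans_lt h1
    rw [div_le_iff₀ hT]
    nlinarith [Real.sq_sqrt (mul_nonneg hδ hD)]
  · linarith

/-- The weak-signal analysis runs up to a large multiple B of the threshold, beyond the first case
of the rate. There the rate has dropped by at most the factor B. -/
theorem sqrt_le_mul_localRate (hD : (0 : ℝ) < (d : ℝ) / n) {B : ℝ} (hB : 1 ≤ B)
    (hT : ‖θ‖ ^ 2 ≤ B * Real.sqrt ((d : ℝ) / n * max δ ((d : ℝ) / n))) :
    Real.sqrt ((d : ℝ) / n * max δ ((d : ℝ) / n)) ≤ B * localRate n δ θ := by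
  rw [localRate_eq]
  set D : ℝ := (d : ℝ) / n
  set q := max δ D with hq
  set T := ‖θ‖ ^ 2
  have hqD : D ≤ q := le_max_right _ _
  have hr2 : Real.sqrt (D * q) ^ 2 = D * q := Real.sq_sqrt (by positivity)
  have hr0 : 0 < Real.sqrt (D * q) := Real.sqrt_pos.2 (mul_pos hD (hD.trans_le hqD))
  split_ifs with h1 h2
  · have h3 : Real.sqrt (D * q) ≤ Real.sqrt (δ * D) + D := by
      rw [hq, sqrt_mul_max_eq hD.le]
      exact max_le (by linarith) (by linarith [Real.sqrt_nonneg (δ * D)])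
    have h4 := (Real.sqrt_nonneg (D * q)).trans h3
    nlinarith
  · rw [not_le] at h1
    have hqδ := max_eq_left_of_sqrt_lt hD.le h1 h2
    rw [← hqδ, ← hq, mul_div_assoc', le_div_iff₀ (hr0.trans h1),
      show q * D = Real.sqrt (D * q) ^ 2 by rw [hr2, mul_comm]]
    nlinarith
  · rw [not_le] at h2
    have h3 : Real.sqrt (D * q) * Real.sqrt (D * q) ≤ B * D * Real.sqrt (D * q) := by
      nlinarith
    exact le_of_mul_le_mul_right h3 hr0

/-- The second summand dominates when T ≤ q (then q = δ), the first when T > q. -/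
theorem add_div_le_two_mul_localRate (hD : (0 : ℝ) < (d : ℝ) / n)
    (hT : Real.sqrt ((d : ℝ) / n * max δ ((d : ℝ) / n)) < ‖θ‖ ^ 2) :
    (d : ℝ) / n + (d : ℝ) / n * max δ ((d : ℝ) / n) / ‖θ‖ ^ 2 ≤ 2 * localRate n δ θ := by
  rw [localRate_eq, if_neg (not_le.2 hT)]
  set D : ℝ := (d : ℝ) / n
  have hT0 : 0 < ‖θ‖ ^ 2 := (Real.sqrt_nonneg _).trans_lt hT
  split_ifs with h2
  · have hqδ := max_eq_left_of_sqrt_lt hD.le hT h2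
    rw [hqδ] at h2 ⊢
    have h3 : D ≤ δ * D / ‖θ‖ ^ 2 := by
      rw [le_div_iff₀ hT0]; nlinarith
    rw [mul_comm D δ]
    linarith
  · rw [not_le] at h2
    have h3 : D * max δ D / ‖θ‖ ^ 2 ≤ D := by
      rw [div_le_iff₀ hT0]; nlinarith
    linarith

end Rates

/-! ### The two regimes of the signal strength -/

/-- The perturbation level of the sample covariance with `n p` buckets. -/
noncomputable def perturbation (D τ p : ℝ) : ℝ := 1152 * (τ * Real.sqrt D + Real.sqrt (D * p))

section Regimes

variable {D q τ p₀ p S₀ : ℝ}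

/-- With r = √(Dq) one has D ≤ r ≤ q. The pilot S₀ is of order r, so p is of order q and the
perturbation of order r, whatever value the second stage picks. -/
theorem weak_signal (hD : 0 < D) (hq : D ≤ q)
    (hT : τ ^ 2 ≤ 10 ^ 12 * Real.sqrt (D * q)) (hp₀ : p₀ ≤ 2 * q) (hp : p ≤ 4 * q + 2 * S₀)
    (hS₀ : S₀ ≤ 8 * (τ ^ 2 + perturbation D τ p₀)) :
    τ ^ 2 + perturbation D τ p ≤ 10 ^ 18 * Real.sqrt (D * q) := by
  have hq0 : 0 < q := hD.trans_le hq
  set r := Real.sqrt (D * q) with hr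
  have hr2 : r ^ 2 = D * q := Real.sq_sqrt (by positivity)
  have hr0 : 0 ≤ r := Real.sqrt_nonneg _
  have hDr : D ≤ r := Real.le_sqrt_of_sq_le (by nlinarith)
  have hrq : r ≤ q := Real.sqrt_le_iff.2 ⟨hq0.le, by nlinarith⟩
  have h1 : τ * Real.sqrt D ≤ 10 ^ 6 * r := by
    refine (le_abs_self _).trans (abs_le_of_sq_le_sq ?_ (by positivity))
    rw [mul_pow, Real.sq_sqrt hD.le]
    nlinarith [mul_nonneg hr0 (sub_nonneg.2 hDr)]
  have h2 : ∀ x c, 1 ≤ c → x ≤ c * q → Real.sqrt (D * x) ≤ c * r := by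
    intro x c hc hx
    refine Real.sqrt_le_iff.2 ⟨by positivity, ?_⟩
    rw [mul_pow, hr2]
    have h3 := mul_le_mul_of_nonneg_left hx hD.le
    have h4 : c * (D * q) ≤ c ^ 2 * (D * q) :=
      mul_le_mul_of_nonneg_right (by nlinarith) (by positivity)
    linarith
  have h3 := h2 p₀ 2 (by norm_num) hp₀
  unfold perturbation at *
  have h4 : S₀ ≤ 9 * 10 ^ 12 * r := by linarith
  have h5 := h2 p (2 * 10 ^ 13) (by norm_num) (by linarith)
  linarith

/-- The threshold 10^12 makes √D at most τ/10^6, so the perturbations are small fractions of τ².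
Then S₀ is comparable to τ² and p is of order at most q + τ². -/
theorem strong_signal (hD : 0 < D) (hq : D ≤ q) (hτ : 0 ≤ τ)
    (hT : 10 ^ 12 * Real.sqrt (D * q) < τ ^ 2) (hp₀ : p₀ ≤ 2 * q) (hp : p ≤ 4 * q + 2 * S₀)
    (hS₀ : S₀ ≤ 8 * (τ ^ 2 + perturbation D τ p₀)) (hS₀' : τ ^ 2 / 16 - perturbation D τ p₀ ≤ S₀) :
    64 * perturbation D τ p ≤ τ ^ 2 ∧ τ ^ 2 / 32 ≤ S₀ ∧
      perturbation D τ p ^ 2 ≤ 10 ^ 9 * (D * τ ^ 2 + D * q) := by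
  have hq0 : 0 < q := hD.trans_le hq
  set r := Real.sqrt (D * q) with hr
  have hr2 : r ^ 2 = D * q := Real.sq_sqrt (by positivity)
  have hr0 : 0 ≤ r := Real.sqrt_nonneg _
  have hDr : D ≤ r := Real.le_sqrt_of_sq_le (by nlinarith)
  have hsD : Real.sqrt D ^ 2 = D := Real.sq_sqrt hD.le
  have hs : Real.sqrt D ≤ τ / 10 ^ 6 := by
    refine Real.sqrt_le_iff.2 ⟨by positivity, ?_⟩
    rw [div_pow]
    linarith
  have h1 : τ * Real.sqrt D ≤ τ ^ 2 / 10 ^ 6 := by nlinarith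
  have h3 : Real.sqrt (D * p₀) ≤ 2 * r := by
    refine Real.sqrt_le_iff.2 ⟨by positivity, ?_⟩
    rw [mul_pow, hr2]
    nlinarith [mul_le_mul_of_nonneg_left hp₀ hD.le, mul_pos hD hq0]
  unfold perturbation at *
  have hS : S₀ ≤ 9 * τ ^ 2 := by linarith
  have hDp : D * p ≤ 4 * (D * q) + 18 * (D * τ ^ 2) := by nlinarith
  have h5 : Real.sqrt (D * p) ≤ 2 * r + 5 * (τ * Real.sqrt D) := by
    refine Real.sqrt_le_iff.2 ⟨by positivity, ?_⟩
    have h6 : 0 ≤ r * (τ * Real.sqrt D) := by positivity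
    have h7 : (τ * Real.sqrt D) ^ 2 = D * τ ^ 2 := by rw [mul_pow, hsD]; ring
    nlinarith [sq_nonneg τ]
  refine ⟨by linarith, by linarith, ?_⟩
  have h7 : (τ * Real.sqrt D) ^ 2 = D * τ ^ 2 := by rw [mul_pow, hsD]; ring
  have h8 : 0 ≤ τ * Real.sqrt D + Real.sqrt (D * p) := by positivity
  have h9 : τ * Real.sqrt D + Real.sqrt (D * p) ≤ 2 * r + 6 * (τ * Real.sqrt D) := by linarith
  have h10 := pow_le_pow_left₀ h8 h9 2
  rw [mul_pow]
  have h11 : (2 * r + 6 * (τ * Real.sqrt D)) ^ 2 ≤ 8 * r ^ 2 + 72 * (τ * Real.sqrt D) ^ 2 := by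
    nlinarith [sq_nonneg (2 * r - 6 * (τ * Real.sqrt D))]
  rw [hr2, h7] at h11
  have h12 : 0 ≤ D * q := by positivity
  have h13 : 0 ≤ D * τ ^ 2 := by positivity
  linarith

end Regimes

/-! ### The two-stage estimator on the good event -/

section Adaptive

variable {d n : ℕ} {δ : ℝ} {θ : EuclideanSpace ℝ (Fin d)}
  {y : Fin n → EuclideanSpace ℝ (Fin d)}
  {vmax : Matrix (Fin d) (Fin d) ℝ → EuclideanSpace ℝ (Fin d)}

/-- `max d ⌈n x⌉ ∧ n` as a fraction of `n`. -/
theorem bucketCount_div_bounds (hd : 1 ≤ d) (hdn : d ≤ n) {x : ℝ} (hx : 0 ≤ x) :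
    ((min (max d ⌈(n : ℝ) * x⌉₊) n : ℕ) : ℝ) / n ≤ (d : ℝ) / n + x ∧
      (min (max d ⌈(n : ℝ) * x⌉₊) n = n ∨
        max ((d : ℝ) / n) x ≤ ((min (max d ⌈(n : ℝ) * x⌉₊) n : ℕ) : ℝ) / n) := by
  have hn0 : (0 : ℝ) < n := by exact_mod_cast hd.trans hdn
  have hd1 : (1 : ℝ) ≤ d := by exact_mod_cast hd
  constructor
  · rw [div_add' _ _ _ hn0.ne']
    refine div_le_div_of_nonneg_right ?_ hn0.le
    have h1 : ((max d ⌈(n : ℝ) * x⌉₊ : ℕ) : ℝ) ≤ d + x * n := by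
      rw [Nat.cast_max]
      refine max_le (by nlinarith) ?_
      have := (Nat.ceil_lt_add_one (mul_nonneg hn0.le hx)).le
      linarith
    exact le_trans (by exact_mod_cast min_le_left _ _) h1
  · rcases le_total n (max d ⌈(n : ℝ) * x⌉₊) with h | h
    · exact Or.inl (min_eq_right h)
    · right
      rw [min_eq_left h, le_div_iff₀ hn0, max_mul_of_nonneg _ _ hn0.le, div_mul_cancel₀ _ hn0.ne',
        Nat.cast_max]
      exact max_le_max le_rfl ((mul_comm _ _).trans_le (Nat.le_ceil _))

theorem signLoss_thetaAdaptive_sq_le (hd : 1 ≤ d) (hdn : d ≤ n) (hδ : 0 < δ)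
    (hvmax : IsTopEigenvectorChoice vmax) {α₀ α : ℝ}
    (h₀ : IsSpectralGood δ θ y (min (max d ⌈(n : ℝ) * δ⌉₊) n) α₀)
    (h : IsSpectralGood δ θ y (ellHat vmax δ y) α) :
    signLoss (thetaAdaptive vmax δ y) θ ^ 2 ≤ 10 ^ 32 * localRate n δ θ := by
  have hn0 : (0 : ℝ) < n := by exact_mod_cast hd.trans hdn
  have hd0 : (0 : ℝ) < d := by exact_mod_cast hd
  set D : ℝ := (d : ℝ) / n with hD
  have hD0 : 0 < D := by positivity
  set q := max δ D with hq
  have hqD : D ≤ q := le_max_right _ _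
  have hqδ : δ ≤ q := le_max_left _ _
  have hq0 : 0 < q := hD0.trans_le hqD
  set ℓ₀ := min (max d ⌈(n : ℝ) * δ⌉₊) n with hℓ₀
  have hℓ₀1 : 1 ≤ ℓ₀ := le_min (hd.trans (le_max_left _ _)) (hd.trans hdn)
  have hp₀ : (ℓ₀ : ℝ) / n ≤ 2 * q := by
    have := (bucketCount_div_bounds hd hdn hδ.le).1
    linarith
  have hE₀ : 0 ≤ labelEnergy n δ ℓ₀ := le_trans (by positivity) h₀.2.2.1.1
  obtain ⟨hS₀, hS₀', -⟩ := h₀.abs_signalEstimate_sub_le hd hℓ₀1 hvmax rfl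
  have hS₀n : 0 ≤ signalEstimate δ y ℓ₀ := signalEstimate_nonneg hE₀
  have hsHat : sHat vmax δ y ^ 2 = signalEstimate δ y ℓ₀ := norm_thetaHat_sq hvmax hE₀
  set S₀ := signalEstimate δ y ℓ₀
  have hell : ellHat vmax δ y = dyadicRoundUp d n (min (max d ⌈(n : ℝ) * max δ S₀⌉₊) n) := by
    rw [ellHat, hsHat]
  obtain ⟨hu1, hu2⟩ := bucketCount_div_bounds hd hdn (le_max_of_le_left hδ.le : 0 ≤ max δ S₀)
  obtain ⟨hL1, hL2, -⟩ := dyadicRoundUp_spec hd hdn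
    (le_min (le_max_left d ⌈(n : ℝ) * max δ S₀⌉₊) hdn) (min_le_right _ _)
  rw [← hell] at hL1 hL2
  have hLn : ellHat vmax δ y ≤ n := by rw [hell]; exact min_le_right _ _
  set ℓ := ellHat vmax δ y with hℓ
  set u := min (max d ⌈(n : ℝ) * max δ S₀⌉₊) n with hu
  have hℓ1 : 1 ≤ ℓ := (le_min (hd.trans (le_max_left _ _)) (hd.trans hdn)).trans hL1
  -- Dyadic rounding costs the factor 2, applied to D + max(δ, S₀) ≤ 2q + S₀.
  have hp : (ℓ : ℝ) / n ≤ 4 * q + 2 * S₀ := by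
    have h1 : (ℓ : ℝ) / n ≤ 2 * ((u : ℝ) / n) := by
      rw [mul_div_assoc']
      exact div_le_div_of_nonneg_right (by exact_mod_cast hL2) hn0.le
    have h2 : max δ S₀ ≤ δ + S₀ := max_le (by linarith) (by linarith)
    linarith
  have hp' : ℓ = n ∨ max q S₀ ≤ (ℓ : ℝ) / n := by
    rcases hu2 with h1 | h1
    · exact Or.inl (le_antisymm hLn (h1 ▸ hL1))
    · right
      have h2 : (u : ℝ) / n ≤ (ℓ : ℝ) / n :=
        div_le_div_of_nonneg_right (by exact_mod_cast hL1) hn0.le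
      refine le_trans (le_of_eq ?_) (h1.trans h2)
      rw [hq, ← max_assoc, max_comm D δ]
  have hp0 : 0 < (ℓ : ℝ) / n := div_pos (by exact_mod_cast hℓ1) hn0
  change signLoss (thetaHat vmax δ y ℓ) θ ^ 2 ≤ _
  rcases le_or_gt (‖θ‖ ^ 2) (10 ^ 12 * Real.sqrt (D * q)) with hT | hT
  · have hw := weak_signal hD0 hqD hT hp₀ hp hS₀
    obtain ⟨hS, -, -⟩ := h.abs_signalEstimate_sub_le hd hℓ1 hvmax rfl
    have hrate := sqrt_le_mul_localRate hD0 (by norm_num) hT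
    have hE : 0 ≤ labelEnergy n δ ℓ := le_trans (by positivity) h.2.2.1.1
    have h1 := signLoss_sq_le_two_mul (thetaHat vmax δ y ℓ) θ
    rw [norm_thetaHat_sq hvmax hE] at h1
    have hpert : 0 ≤ perturbation D ‖θ‖ ((ℓ : ℝ) / n) := by unfold perturbation; positivity
    have hS' : signalEstimate δ y ℓ ≤ 8 * (‖θ‖ ^ 2 + perturbation D ‖θ‖ ((ℓ : ℝ) / n)) := hS
    have hr0 := Real.sqrt_nonneg (D * q)
    linarith
  · obtain ⟨he, hS₀T, he2⟩ := strong_signal hD0 hqD (norm_nonneg θ) hT hp₀ hp hS₀ hS₀'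
    have hr0 := Real.sqrt_nonneg (D * q)
    have hT0 : 0 < ‖θ‖ ^ 2 := by linarith
    have hl := h.signLoss_sq_le hd hℓ1 hvmax (e := perturbation D ‖θ‖ ((ℓ : ℝ) / n)) rfl hT0 he
    have hrate := add_div_le_two_mul_localRate (δ := δ) (θ := θ) hD0
      (show Real.sqrt (D * q) < ‖θ‖ ^ 2 by linarith)
    have h1 : perturbation D ‖θ‖ ((ℓ : ℝ) / n) ^ 2 / ‖θ‖ ^ 2 ≤
        10 ^ 9 * (D + D * q / ‖θ‖ ^ 2) := by
      rw [div_le_iff₀ hT0]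
      refine he2.trans_eq ?_
      rw [mul_assoc, add_mul, div_mul_cancel₀ _ hT0.ne']
    -- If ℓ is capped at n, the lower bound p ≥ max(q, S₀) may fail, but then all buckets have
    -- length one and α is deterministic. Otherwise p ≥ q and p ≥ T/32 give 16DqT/p² ≤ 512D.
    have h2 : (α - labelEnergy n δ ℓ / ℓ) ^ 2 * ‖θ‖ ^ 2 ≤ 512 * D := by
      rcases hp' with h3 | h3
      · rw [← h.2.2.2.2 h3, sub_self]
        have : 0 ≤ 512 * D := by positivity
        simpa using this
      · have hr2 : Real.sqrt (D * q) ^ 2 = D * q := Real.sq_sqrt (by positivity)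
        have h4 : Real.sqrt (δ * D) + D ≤ 2 * Real.sqrt (D * q) := by
          rw [hq, sqrt_mul_max_eq hD0.le]
          linarith [le_max_left (Real.sqrt (δ * D)) D, le_max_right (Real.sqrt (δ * D)) D]
        have h5 : |α - labelEnergy n δ ℓ / ℓ| ≤ 4 * Real.sqrt (D * q) / (ℓ / n) := by
          refine h.2.2.2.1.trans (div_le_div_of_nonneg_right ?_ hp0.le)
          linarith
        have h6 := pow_le_pow_left₀ (abs_nonneg _) h5 2
        rw [sq_abs, div_pow, mul_pow, hr2] at h6
        have h7 : q ≤ (ℓ : ℝ) / n := (le_max_left _ _).trans h3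
        have h8 : ‖θ‖ ^ 2 / 32 ≤ (ℓ : ℝ) / n := hS₀T.trans ((le_max_right _ _).trans h3)
        refine (mul_le_mul_of_nonneg_right h6 hT0.le).trans ?_
        rw [div_mul_eq_mul_div, div_le_iff₀ (by positivity)]
        have h9 : q * (‖θ‖ ^ 2 / 32) ≤ ((ℓ : ℝ) / n) ^ 2 :=
          (mul_le_mul h7 h8 (by positivity) hp0.le).trans_eq (sq _).symm
        have h10 := mul_le_mul_of_nonneg_left h9 hD0.le
        linarith
    have h3 : 0 ≤ D * q / ‖θ‖ ^ 2 := by positivity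
    linarith

end Adaptive

/-! ### The good event -/

section GoodEvent

variable {d n ℓ : ℕ} {δ : ℝ} {θ : EuclideanSpace ℝ (Fin d)}

theorem bucketMean_observations {Ω : Type*} (θ : EuclideanSpace ℝ (Fin d)) (η : Fin n → Ω → ℤˣ)
    (ξ : Fin n → Ω → EuclideanSpace ℝ (Fin d)) (ω : Ω) (i : Fin ℓ) :
    bucketMean ℓ (observations θ η ξ ω) i =
      labelMean ℓ (fun j => η j ω) i • θ + bucketMean ℓ (fun j => ξ j ω) i := by
  simp only [labelMean, bucketMean_def, observations, sum_add_distrib, smul_add, smul_eq_mul,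
    ← sum_smul, mul_smul]

theorem labelMean_self_sq (hn : 1 ≤ n) (s : Fin n → ℤˣ) (i : Fin n) : labelMean n s i ^ 2 = 1 := by
  refine labelMean_sq_eq_one hn le_rfl i fun t ht => ?_
  have hk : bucketLength n n = 1 := Nat.div_self hn
  simp only [innerBucket, hk, Nat.div_one, mem_filter, mem_univ, true_and] at ht
  omega

/-- The average squared label mean. -/
noncomputable def labelAvg (ℓ : ℕ) (s : Fin n → ℤˣ) : ℝ :=
  (∑ i : Fin ℓ, labelMean ℓ s i ^ 2) / ℓ

theorem abs_cross_le {E : Type*} [NormedAddCommGroup E] [InnerProductSpace ℝ E] (x z θ w : E) :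
    |inner ℝ x θ * inner ℝ z w + inner ℝ z θ * inner ℝ x w| ≤
      2 * ‖θ‖ * ‖w‖ * ‖x‖ * ‖z‖ := by
  have h : ∀ a b : E, |inner ℝ a θ * inner ℝ b w| ≤ ‖θ‖ * ‖w‖ * ‖a‖ * ‖b‖ := fun a b => by
    rw [abs_mul]
    calc _ ≤ (‖a‖ * ‖θ‖) * (‖b‖ * ‖w‖) :=
          mul_le_mul (abs_real_inner_le_norm a θ) (abs_real_inner_le_norm b w) (abs_nonneg _)
            (by positivity)
      _ = _ := by ring
  refine (abs_add_le _ _).trans ((add_le_add (h x z) (h z x)).trans_eq ?_)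
  ring

theorem form_sub_le {s : Fin n → ℤˣ} {z : Fin ℓ → EuclideanSpace ℝ (Fin d)}
    {y : Fin n → EuclideanSpace ℝ (Fin d)} (hl : 1 ≤ ℓ) (hln : ℓ ≤ n)
    (hy : ∀ i, bucketMean ℓ y i = labelMean ℓ s i • θ + z i)
    (hnoise : ∀ x u, |noiseForm (bucketLength n ℓ) z x u| ≤
      4 * (144 * Real.sqrt (d * ℓ) / bucketLength n ℓ) * ‖x‖ * ‖u‖)
    (hcross : ‖∑ i, labelMean ℓ s i • z i‖ ≤ 2 * (3 * Real.sqrt (d * ℓ / bucketLength n ℓ)))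
    (x u : EuclideanSpace ℝ (Fin d)) :
    |inner ℝ x (Matrix.toEuclideanLin (sampleCov ℓ y) u) -
      labelAvg ℓ s * (inner ℝ x θ * inner ℝ u θ) - 1 / (bucketLength n ℓ : ℝ) * inner ℝ x u| ≤
      1152 * (‖θ‖ * Real.sqrt (d / n) + Real.sqrt (d / n * (ℓ / n))) * ‖x‖ * ‖u‖ := by
  have hk : (0 : ℝ) < bucketLength n ℓ := by exact_mod_cast bucketLength_pos hl hln
  have hl0 : (0 : ℝ) < ℓ := by exact_mod_cast hl
  have hn0 : (0 : ℝ) < n := by exact_mod_cast hl.trans hln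
  have hkn := le_two_mul_bucketLength_mul hl hln
  set k : ℝ := (bucketLength n ℓ : ℝ) with hkdef
  set W := ∑ i, labelMean ℓ s i • z i with hW
  -- The error splits into a signal-noise cross term through W and the centred noise form; the
  -- constant 1152 is 4·144, doubled when n/k is replaced by 2ℓ.
  have hid : inner ℝ x (Matrix.toEuclideanLin (sampleCov ℓ y) u) -
      labelAvg ℓ s * (inner ℝ x θ * inner ℝ u θ) - 1 / k * inner ℝ x u =
      1 / (ℓ : ℝ) * (inner ℝ x θ * inner ℝ u W + inner ℝ u θ * inner ℝ x W) +
        1 / (ℓ : ℝ) * noiseForm k z x u := by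
    rw [inner_toEuclideanLin_sampleCov, labelAvg, noiseForm_apply, hW]
    simp only [hy, inner_add_right, real_inner_smul_right, inner_sum]
    have : ∀ i, (labelMean ℓ s i * inner ℝ x θ + inner ℝ x (z i)) *
        (labelMean ℓ s i * inner ℝ u θ + inner ℝ u (z i)) =
        labelMean ℓ s i ^ 2 * (inner ℝ x θ * inner ℝ u θ) +
          inner ℝ x θ * (labelMean ℓ s i * inner ℝ u (z i)) +
          inner ℝ u θ * (labelMean ℓ s i * inner ℝ x (z i)) +
          inner ℝ x (z i) * inner ℝ u (z i) := fun i => by ring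
    simp only [this, sum_add_distrib, ← sum_mul, ← mul_sum]
    field_simp
    ring
  have hX : 0 ≤ ‖x‖ * ‖u‖ := by positivity
  have h1 : Real.sqrt (d * ℓ / k) ≤ 2 * ℓ * Real.sqrt (d / n) := by
    refine Real.sqrt_le_iff.2 ⟨by positivity, ?_⟩
    rw [mul_pow, Real.sq_sqrt (by positivity), div_le_iff₀ hk, mul_div_assoc', div_mul_eq_mul_div,
      le_div_iff₀ hn0]
    have : (0 : ℝ) ≤ d * ℓ := by positivity
    nlinarith
  have h2 : Real.sqrt (d * ℓ) = n * Real.sqrt (d / n * (ℓ / n)) := by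
    rw [← Real.sqrt_sq hn0.le, ← Real.sqrt_mul (sq_nonneg _), Real.sqrt_sq hn0.le]
    congr 1
    field_simp
  have h3 : |1 / (ℓ : ℝ) * (inner ℝ x θ * inner ℝ u W + inner ℝ u θ * inner ℝ x W)| ≤
      24 * (‖θ‖ * Real.sqrt (d / n)) * (‖x‖ * ‖u‖) := by
    rw [abs_mul, abs_of_pos (by positivity), one_div, inv_mul_le_iff₀ hl0]
    refine (abs_cross_le x u θ W).trans ?_
    have h4 : ‖W‖ ≤ 12 * ℓ * Real.sqrt (d / n) := by linarith
    have h5 := mul_le_mul_of_nonneg_left h4 (by positivity : 0 ≤ 2 * ‖θ‖ * (‖x‖ * ‖u‖))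
    linarith
  have h4 : |1 / (ℓ : ℝ) * noiseForm k z x u| ≤
      1152 * Real.sqrt (d / n * (ℓ / n)) * (‖x‖ * ‖u‖) := by
    rw [abs_mul, abs_of_pos (by positivity), one_div, inv_mul_le_iff₀ hl0]
    refine (hnoise x u).trans ?_
    rw [h2]
    have h5 : (n : ℝ) / k ≤ 2 * ℓ := by rw [div_le_iff₀ hk]; linarith
    have h6 := mul_le_mul_of_nonneg_left h5
      (by positivity : 0 ≤ 576 * Real.sqrt (d / n * (ℓ / n)) * (‖x‖ * ‖u‖))
    calc _ = 576 * Real.sqrt (d / n * (ℓ / n)) * (‖x‖ * ‖u‖) * (n / k) := by ring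
      _ ≤ _ := h6
      _ = _ := by ring
  rw [hid]
  refine (abs_add_le _ _).trans ((add_le_add h3 h4).trans ?_)
  have : 0 ≤ ‖θ‖ * Real.sqrt (d / n) * (‖x‖ * ‖u‖) := by positivity
  linarith

variable {Ω : Type*} [MeasurableSpace Ω] {μ : Measure Ω} [IsProbabilityMeasure μ]
  {η : Fin n → Ω → ℤˣ} {ξ : Fin n → Ω → EuclideanSpace ℝ (Fin d)}

theorem isSpectralGood_of (hM : IsMarkovMixtureModel μ δ η ξ) (hδ0 : 0 < δ) (hδ : δ < 1 / 2)
    (hl : 1 ≤ ℓ) (hln : ℓ ≤ n) (hnδ : n * δ ≤ ℓ) {ω : Ω}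
    (hnoise : ∀ x u, |noiseForm (bucketLength n ℓ)
      (fun i : Fin ℓ => bucketMean ℓ (fun j => ξ j ω) i) x u| ≤
      4 * (144 * Real.sqrt (d * ℓ) / bucketLength n ℓ) * ‖x‖ * ‖u‖)
    (hcross : ‖∑ i, labelMean ℓ (fun j => η j ω) i • bucketMean ℓ (fun j => ξ j ω) i‖ ≤
      2 * (3 * Real.sqrt (d * ℓ / bucketLength n ℓ)))
    (hlow : labelEnergy n δ ℓ / 2 ≤ ∑ i : Fin ℓ, labelMean ℓ (fun j => η j ω) i ^ 2)
    (hdev : |∑ i : Fin ℓ, labelMean ℓ (fun j => η j ω) i ^ 2 - labelEnergy n δ ℓ| ≤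
      2 * (Real.sqrt (n * δ * d) + d)) :
    IsSpectralGood δ θ (observations θ η ξ ω) ℓ (labelAvg ℓ fun j => η j ω) := by
  have hl0 : (0 : ℝ) < ℓ := by exact_mod_cast hl
  have hn0 : (0 : ℝ) < n := by exact_mod_cast hl.trans hln
  have hkδ : (bucketLength n ℓ : ℝ) * δ ≤ 1 := by
    refine le_of_mul_le_mul_right ?_ hl0
    have := mul_le_mul_of_nonneg_right (bucketLength_mul_le n ℓ) hδ0.le
    linarith
  have hE := le_labelEnergy hδ0.le hδ.le hM.measurable_label hM.label_law hl hln hkδ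
  have hE' := labelEnergy_le hM.measurable_label hM.label_law hl hln
  refine ⟨form_sub_le hl hln (fun i => bucketMean_observations θ η ξ ω i) hnoise hcross, ⟨?_, ?_⟩,
    ⟨hE, hE'⟩, ?_, ?_⟩
  · rw [labelAvg, le_div_iff₀ hl0]
    linarith
  · rw [labelAvg, div_le_one hl0]
    refine (sum_le_card_nsmul univ _ 1 fun i _ => labelMean_sq_le_one hl hln _ i).trans ?_
    simp
  · rw [labelAvg, ← sub_div, abs_div, abs_of_pos hl0]
    have h1 : Real.sqrt (n * δ * d) = n * Real.sqrt (δ * (d / n)) := by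
      rw [← Real.sqrt_sq hn0.le, ← Real.sqrt_mul (sq_nonneg _), Real.sqrt_sq hn0.le]
      congr 1
      field_simp
    rw [h1] at hdev
    refine (div_le_div_of_nonneg_right hdev hl0.le).trans_eq ?_
    field_simp
  · rintro rfl
    rw [labelAvg, labelEnergy_eq_sum_integral hM.measurable_label hM.label_law hl hln]
    simp [labelMean_self_sq hl]

/-- Four failures with prefactors 4 + 2 + 1 + 2 = 9: noise form, cross term, low label energy, label
deviation. The low-energy bound e^(-ℓ/128) sets the exponent, through ℓ ≥ d. -/
theorem measureReal_not_isSpectralGood_le (hM : IsMarkovMixtureModel μ δ η ξ) (hδ0 : 0 < δ)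
    (hδ : δ < 1 / 2) (hd : 1 ≤ d) (hdl : d ≤ ℓ) (hln : ℓ ≤ n) (hnδ : n * δ ≤ ℓ) :
    μ.real {ω | ¬ IsSpectralGood δ θ (observations θ η ξ ω) ℓ (labelAvg ℓ fun j => η j ω)} ≤
      9 * Real.exp (-(d / 128 : ℝ)) := by
  have hl := hd.trans hdl
  have hl0 : (0 : ℝ) < ℓ := by exact_mod_cast hl
  have hd0 : (0 : ℝ) < d := by exact_mod_cast hd
  have hdl' : (d : ℝ) ≤ ℓ := by exact_mod_cast hdl
  have hkδ : (bucketLength n ℓ : ℝ) * δ ≤ 1 := by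
    refine le_of_mul_le_mul_right ?_ hl0
    have := mul_le_mul_of_nonneg_right (bucketLength_mul_le n ℓ) hδ0.le
    linarith
  have h1 := measureReal_exists_abs_noiseForm_gt_le hd hM.measurable_noise hM.noise_indep
    hM.noise_subGaussian hdl hln
  have h2 := measureReal_norm_sum_labelMean_smul_gt_le hd hM.measurable_label hM.measurable_noise
    hM.noise_indep hM.noise_subGaussian hM.noise_indep_label hl hln
  have h3 := measureReal_sum_labelMean_sq_le hδ0.le hδ.le hM.measurable_label hM.label_law hl hln hkδ
  have h4 := measureReal_abs_sum_labelMean_sq_sub_ge_le hδ0 (by linarith) hM.measurable_label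
    hM.label_law hd hl hln
  set A₁ := {ω | ∃ x y, 4 * (144 * Real.sqrt (d * ℓ) / bucketLength n ℓ) * ‖x‖ * ‖y‖ <
    |noiseForm (bucketLength n ℓ) (fun i : Fin ℓ => bucketMean ℓ (fun j => ξ j ω) i) x y|}
  set A₂ := {ω | 2 * (3 * Real.sqrt (d * ℓ / bucketLength n ℓ)) <
    ‖∑ i, labelMean ℓ (fun j => η j ω) i • bucketMean ℓ (fun j => ξ j ω) i‖}
  set A₃ := {ω | ∑ i : Fin ℓ, labelMean ℓ (fun j => η j ω) i ^ 2 ≤ labelEnergy n δ ℓ / 2}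
  set A₄ := {ω | 2 * (Real.sqrt (n * δ * d) + d) ≤
    |∑ i : Fin ℓ, labelMean ℓ (fun j => η j ω) i ^ 2 - labelEnergy n δ ℓ|}
  have hsub : {ω | ¬ IsSpectralGood δ θ (observations θ η ξ ω) ℓ (labelAvg ℓ fun j => η j ω)} ⊆
      (A₁ ∪ A₂) ∪ (A₃ ∪ A₄) := by
    intro ω hω
    by_contra hc
    simp only [Set.mem_union, not_or, A₁, A₂, A₃, A₄, Set.mem_ofPred_eq, not_exists, not_lt,
      not_le] at hc
    obtain ⟨⟨c1, c2⟩, c3, c4⟩ := hc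
    exact hω (isSpectralGood_of hM hδ0 hδ hl hln hnδ c1 c2 c3.le c4.le)
  have he1 : Real.exp (-(d : ℝ)) ≤ Real.exp (-(d / 128 : ℝ)) := Real.exp_le_exp.2 (by linarith)
  have he2 : Real.exp (-(ℓ / 128 : ℝ)) ≤ Real.exp (-(d / 128 : ℝ)) := Real.exp_le_exp.2 (by linarith)
  have hu := (measureReal_mono hsub (measure_ne_top μ _)).trans
    ((measureReal_union_le _ _).trans (add_le_add (measureReal_union_le A₁ A₂)
      (measureReal_union_le A₃ A₄)))
  linarith

end GoodEvent

/-! ### The union bound over the grid -/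

/-- The count is the grid plus the pilot. For n close to d the logarithm can be of order 1/d, so the
count is only bounded by 8d·log(n/d); half of the exponent absorbs d, via d·e^(-d/256) ≤ 256, and
18432 = 9·8·256. -/
theorem grid_card_mul_exp_le {d n : ℕ} (hd : 1 ≤ d) (hdn : d ≤ n) :
    ((⌈Real.logb 2 ((n : ℝ) / d)⌉₊ : ℝ) + 2) * (9 * Real.exp (-(d / 128 : ℝ))) ≤
      18432 * (if d < n then Real.log ((n : ℝ) / d) else 1) * Real.exp (-(1 / 256) * d) := by
  have hd0 : (0 : ℝ) < d := by exact_mod_cast hd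
  have hd1 : (1 : ℝ) ≤ d := by exact_mod_cast hd
  have hexp : Real.exp (-(d / 128 : ℝ)) =
      Real.exp (-(1 / 256) * d) * Real.exp (-(1 / 256) * d) := by
    rw [← Real.exp_add]; congr 1; ring
  have hde : (d : ℝ) * Real.exp (-(1 / 256) * d) ≤ 256 := by
    have h1 := Real.add_one_le_exp ((1 / 256 : ℝ) * d)
    rw [neg_mul, Real.exp_neg, ← div_eq_mul_inv, div_le_iff₀ (Real.exp_pos _)]
    linarith
  have hpos := Real.exp_pos (-(1 / 256) * (d : ℝ))
  rw [hexp]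
  set e := Real.exp (-(1 / 256) * (d : ℝ))
  have key : ∀ g lg : ℝ, g ≤ 8 * d * lg → 0 ≤ lg → g * (9 * (e * e)) ≤ 18432 * lg * e := by
    intro g lg hg hlg
    have h1 := mul_le_mul_of_nonneg_right hg (by positivity : 0 ≤ 9 * (e * e))
    have h2 := mul_le_mul_of_nonneg_right hde (by positivity : 0 ≤ 72 * lg * e)
    linarith
  split_ifs with h
  · have hdn' : (d : ℝ) + 1 ≤ n := by exact_mod_cast h
    have hn0 : (0 : ℝ) < n := by linarith
    have hlg : 1 / (2 * d) ≤ Real.log ((n : ℝ) / d) := by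
      refine le_trans ?_ (Real.one_sub_inv_le_log_of_pos (by positivity))
      rw [inv_div, div_le_iff₀ (by positivity)]
      have : (d : ℝ) / n ≤ d / (d + 1) := div_le_div_of_nonneg_left hd0.le (by linarith) hdn'
      have h2 : (d : ℝ) / (d + 1) ≤ 1 - 1 / (2 * d) := by
        rw [div_le_iff₀ (by linarith), sub_mul, one_mul, div_mul_eq_mul_div, one_mul,
          le_sub_iff_add_le, ← le_sub_iff_add_le', div_le_iff₀ (by positivity)]
        linarith
      have h3 : (1 - (d : ℝ) / n) * (2 * d) ≥ 1 / (2 * d) * (2 * d) :=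
        mul_le_mul_of_nonneg_right (by linarith) (by positivity)
      rw [one_div_mul_cancel (by positivity)] at h3
      exact h3
    set lg := Real.log ((n : ℝ) / d) with hlgdef
    have hlg0 : 0 < lg := lt_of_lt_of_le (by positivity) hlg
    refine key _ _ ?_ hlg0.le
    rw [div_le_iff₀ (by positivity)] at hlg
    have hb : Real.logb 2 ((n : ℝ) / d) ≤ 2 * lg := by
      rw [Real.logb, ← hlgdef, div_le_iff₀ (Real.log_pos (by norm_num))]
      nlinarith [Real.log_two_gt_d9]
    have hb0 : 0 ≤ Real.logb 2 ((n : ℝ) / d) :=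
      div_nonneg hlg0.le (Real.log_pos (by norm_num)).le
    have := (Nat.ceil_lt_add_one hb0).le
    nlinarith
  · have hnd : n = d := le_antisymm (not_lt.1 h) hdn
    refine key _ _ ?_ zero_le_one
    rw [hnd, div_self hd0.ne', Real.logb_one, Nat.ceil_zero]
    push_cast
    linarith

theorem le_mul_two_pow_ceil_logb {d n : ℕ} (hd : 1 ≤ d) (hdn : d ≤ n) :
    n ≤ d * 2 ^ ⌈Real.logb 2 ((n : ℝ) / d)⌉₊ := by
  have hd0 : (0 : ℝ) < d := by exact_mod_cast hd
  have hn0 : (0 : ℝ) < n := by exact_mod_cast hd.trans hdn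
  have h := Nat.le_ceil (Real.logb 2 ((n : ℝ) / d))
  rw [Real.logb_le_iff_le_rpow (by norm_num) (by positivity), Real.rpow_natCast,
    div_le_iff₀ hd0, mul_comm] at h
  exact_mod_cast h

/-- The bound on the loss is deterministic once the good event holds at the pilot and at every grid
value ≥ nδ, one of which is the random choice. Only inclusions of events are used, so `vmax` need
not be measurable. -/
theorem measureReal_signLoss_thetaAdaptive_le {d n : ℕ} (hd : 1 ≤ d) (hdn : d ≤ n) {δ : ℝ}
    (hδ0 : 0 < δ) (hδ : δ < 1 / 2) (θ : EuclideanSpace ℝ (Fin d)) {Ω : Type*} [MeasurableSpace Ω]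
    {μ : Measure Ω} [IsProbabilityMeasure μ] {η : Fin n → Ω → ℤˣ}
    {ξ : Fin n → Ω → EuclideanSpace ℝ (Fin d)} (hM : IsMarkovMixtureModel μ δ η ξ)
    {vmax : Matrix (Fin d) (Fin d) ℝ → EuclideanSpace ℝ (Fin d)}
    (hvmax : IsTopEigenvectorChoice vmax) :
    μ.real {ω | 10 ^ 32 * localRate n δ θ <
      signLoss (thetaAdaptive vmax δ (observations θ η ξ ω)) θ ^ 2} ≤
      18432 * (if d < n then Real.log ((n : ℝ) / d) else 1) * Real.exp (-(1 / 256) * d) := by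
  classical
  have hn0 : (0 : ℝ) < n := by exact_mod_cast hd.trans hdn
  have hnδ : n * δ ≤ n := by nlinarith
  set M := ⌈Real.logb 2 ((n : ℝ) / d)⌉₊ with hMdef
  let bad : ℕ → Set Ω := fun ℓ =>
    {ω | ¬ IsSpectralGood δ θ (observations θ η ξ ω) ℓ (labelAvg ℓ fun j => η j ω)}
  have hbad : ∀ ℓ : ℕ, d ≤ ℓ → ℓ ≤ n → n * δ ≤ ℓ →
      μ.real (bad ℓ) ≤ 9 * Real.exp (-(d / 128 : ℝ)) := fun ℓ h1 h2 h3 =>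
    measureReal_not_isSpectralGood_le hM hδ0 hδ hd h1 h2 h3
  let grid : Finset ℕ := ((range (M + 1)).image fun m => min (d * 2 ^ m) n).filter
    fun ℓ => n * δ ≤ (ℓ : ℝ)
  set ℓ₀ := min (max d ⌈(n : ℝ) * δ⌉₊) n with hℓ₀
  have hstart : ∀ x : ℝ, δ ≤ x → n * δ ≤ ((min (max d ⌈(n : ℝ) * x⌉₊) n : ℕ) : ℝ) := by
    intro x hx
    rw [Nat.cast_min, Nat.cast_max]
    refine le_min (le_max_of_le_right ?_) hnδ
    exact (mul_le_mul_of_nonneg_left hx hn0.le).trans (Nat.le_ceil _)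
  have hsub : {ω | 10 ^ 32 * localRate n δ θ <
      signLoss (thetaAdaptive vmax δ (observations θ η ξ ω)) θ ^ 2} ⊆
      bad ℓ₀ ∪ ⋃ ℓ ∈ grid, bad ℓ := by
    intro ω hω
    by_contra hc
    simp only [Set.mem_union, not_or, Set.mem_iUnion, not_exists, bad, Set.mem_ofPred_eq,
      not_not] at hc
    obtain ⟨h₀, h₁⟩ := hc
    have hmem : ellHat vmax δ (observations θ η ξ ω) ∈ grid := by
      obtain ⟨hL1, -, hL3⟩ := dyadicRoundUp_spec hd hdn
        (le_min (le_max_left d ⌈(n : ℝ) * max δ (sHat vmax δ (observations θ η ξ ω) ^ 2)⌉₊) hdn)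
        (min_le_right _ _)
      obtain ⟨m, hm, hmeq⟩ := hL3 M (le_mul_two_pow_ceil_logb hd hdn)
      refine mem_filter.2 ⟨mem_image.2 ⟨m, mem_range.2 (by omega), hmeq.symm⟩, ?_⟩
      exact (hstart _ (le_max_left _ _)).trans (by exact_mod_cast hL1)
    exact absurd hω (not_lt.2 (signLoss_thetaAdaptive_sq_le hd hdn hδ0 hvmax h₀ (h₁ _ hmem)))
  have hcard : #grid ≤ M + 1 :=
    (card_filter_le _ _).trans (card_image_le.trans_eq (card_range _))
  have hgrid : ∑ ℓ ∈ grid, μ.real (bad ℓ) ≤ ((M : ℝ) + 1) * (9 * Real.exp (-(d / 128 : ℝ))) := by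
    refine (sum_le_card_nsmul _ _ (9 * Real.exp (-(d / 128 : ℝ))) fun ℓ hℓ => ?_).trans ?_
    · obtain ⟨h1, h2⟩ := mem_filter.1 hℓ
      obtain ⟨m, -, rfl⟩ := mem_image.1 h1
      exact hbad _ (le_min (Nat.le_mul_of_pos_right _ (by positivity)) hdn) (min_le_right _ _) h2
    · rw [nsmul_eq_mul]
      exact mul_le_mul_of_nonneg_right (by exact_mod_cast hcard) (by positivity)
  refine le_trans ?_ (grid_card_mul_exp_le hd hdn)
  refine (measureReal_mono hsub (measure_ne_top μ _)).trans ((measureReal_union_le _ _).trans ?_)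
  have h1 := hbad ℓ₀ (le_min (le_max_left _ _) hdn) (min_le_right _ _) (hstart δ le_rfl)
  have h2 := measureReal_biUnion_finset_le (μ := μ) grid bad
  linarith

theorem theorem2 :
    ∃ C c₀ c₁ : ℝ, 0 < C ∧ 0 < c₀ ∧ 0 < c₁ ∧
      ∀ (d n : ℕ), 1 ≤ d → d ≤ n → ∀ (δ : ℝ), 0 < δ → δ < 1 / 2 →
      ∀ (θ : EuclideanSpace ℝ (Fin d))
        (Ω : Type*) [MeasurableSpace Ω] (μ : Measure Ω) [IsProbabilityMeasure μ]
        (η : Fin n → Ω → ℤˣ) (ξ : Fin n → Ω → EuclideanSpace ℝ (Fin d)),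
      IsMarkovMixtureModel μ δ η ξ →
      ∀ (vmax : Matrix (Fin d) (Fin d) ℝ → EuclideanSpace ℝ (Fin d)),
      IsTopEigenvectorChoice vmax →
        μ.real {ω | C * localRate n δ θ <
            signLoss (thetaAdaptive vmax δ (observations θ η ξ ω)) θ ^ 2} ≤
          c₁ * (if d < n then Real.log ((n : ℝ) / d) else 1) * Real.exp (-c₀ * d) ∧
        μ.real {ω | C * globalRate d n δ <
            signLoss (thetaAdaptive vmax δ (observations θ η ξ ω)) θ ^ 2} ≤
          c₁ * (if d < n then Real.log ((n : ℝ) / d) else 1) * Real.exp (-c₀ * d) := by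
  -- The size of C comes from weak signals: about 16·10^18 for the loss against √(Dq), times 10^12
  -- for comparing √(Dq) with the local rate.
  refine ⟨10 ^ 32, 1 / 256, 18432, by norm_num, by norm_num, by norm_num, ?_⟩
  intro d n hd hdn δ hδ0 hδ θ Ω _ μ _ η ξ hM vmax hvmax
  have h := measureReal_signLoss_thetaAdaptive_le hd hdn hδ0 hδ θ hM hvmax
  refine ⟨h, (measureReal_mono (fun ω hω => ?_) (measure_ne_top μ _)).trans h⟩
  simp only [Set.mem_ofPred_eq] at hω ⊢
  refine lt_of_le_of_lt ?_ hω
  exact mul_le_mul_of_nonneg_left (localRate_le_globalRate hδ0.le) (by norm_num)
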